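/- **Setting.** Let $d\ge 1$ and let $\Omega\subset\mathbb{R}^d$ be a nonempty bounded open set (for instance a bounded polytopal domain, $d\in\{1,2,3\}$). Let $V=H^1_0(\Omega)$ be the closure of $C_c^\infty(\Omega)$ in $H^1(\Omega)$, equipped for $\lambda>0$ with the equivalent norms $|||v|||_\lambda=(\lambda\|\nabla v\|_{L^2(\Omega)}^2+\|v\|_{L^2(\Omega)}^2)^{1/2}$, and let $C_P>0$ be the (best) Poincaré constant, $\|v\|_{L^2(\Omega)}^2\le C_P\|\nabla v\|_{L^2(\Omega)}^2$ for all $v\in V$. Let $f:\Omega\times\mathbb{R}\to\mathbb{R}$ be measurable in the first variable and differentiable in the second, with $f(\cdot,0)\in L^2(\Omega)$. For $\lambda,\rho>0$ put $$\sigma_f(\lambda)=\operatorname*{ess\,sup}_{x\in\Omega}\,\sup_{u\in\mathbb{R}}\Big|\frac{\partial f}{\partial u}(x,u)+\frac1\lambda\Big|\in[0,\infty],\qquad \Lambda_f(\rho)=\Big\{\lambda>0:\ \sigma_f(\lambda)<\rho+\frac1\lambda\Big\}.$$ Assume that $\Lambda_f(\rho)\neq\emptyset$ for some given $\rho>0$,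 and set $$\mu_f=\begin{cases}(\sup\Lambda_f(\rho))^{-1}&\text{if }\sup\Lambda_f(\rho)<\infty,\\0&\text{otherwise,}\end{cases}\qquad \kappa_f=\max\Big\{\mu_f+\frac{\rho}{2}-\frac{1}{2C_P},\,0\Big\}.$$ Define the energy $$E(v)=\frac12\int_\Omega|\nabla v|^2\,dx-\int_\Omega\int_0^{v(x)}f(x,s)\,ds\,dx,\qquad v\in V,$$ and call $E$ weakly coercive if $E(v)\to+\infty$ whenever $|||v|||_\lambda\to\infty$, $v\in V$, for some (equivalently, every) $\lambda>0$. **Theorem (Convergence in closed subspaces).** Let $W\subseteq V$ be a closed linear subspace, let $\Delta t>0$ satisfy $1/\Delta t>\kappa_f$, and let $E$ be weakly coercive. Let $u^0\in L^2(\Omega)$ be arbitrary and let $u^{n+1}\in W$, $n\ge0$, be generated by $$\int_\Omega\big(\Delta t\,\nabla u^{n+1}\cdot\nabla v+u^{n+1}v\big)\,dx=\int_\Omega\big(u^n+\Delta t\,f(x,u^n)\big)v\,dx\qquad\forall v\in W.$$ Then there are a subsequence $(u^{n'})$, consisting of elements of $W$, and some $u^\star\in W$ such that $u^{n'}\rightharpoonup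 u^\star$ weakly in $W$, $u^{n'}\to u^\star$ strongly in $L^2(\Omega)$, and $u^\star$ solves the Galerkin problem $$\int_\Omega\nabla u^\star\cdot\nabla v\,dx=\int_\Omega f(x,u^\star)\,v\,dx\qquad\forall v\in W.$$ -/

import Mathlib

open MeasureTheory Filter Topology TopologicalSpace
open scoped ENNReal

noncomputable section

namespace SemilinearGalerkin

/-- The Euclidean space `ℝ^d`. -/
abbrev Space (d : ℕ) : Type := EuclideanSpace ℝ (Fin d)

/-- Lebesgue measure on the open set `Ω`. -/
abbrev vol {d : ℕ} (Ω : Opens (Space d)) : Measure (Space d) :=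
  (volume : Measure (Space d)).restrict (Ω : Set (Space d))

/-- `L²(Ω)`. -/
abbrev L2 {d : ℕ} (Ω : Opens (Space d)) : Type := Lp ℝ 2 (vol Ω)

/-- `L²(Ω)^d`, the square integrable vector fields. -/
abbrev L2Vec {d : ℕ} (Ω : Opens (Space d)) : Type := Lp (Space d) 2 (vol Ω)

/-- `g` is the weak gradient of `v` on `Ω`: `∫_Ω v ∂ᵢφ = - ∫_Ω gᵢ φ` for all `φ ∈ C_c^∞(Ω)` and
all `i`. -/
def IsWeakGradient {d : ℕ} {Ω : Opens (Space d)} (v : L2 Ω) (g : L2Vec Ω) : Prop :=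
  ∀ (φ : TestFunction Ω ℝ ⊤) (i : Fin d),
    ∫ x, v x * fderiv ℝ φ x (EuclideanSpace.single i 1) ∂(vol Ω) = - ∫ x, g x i * φ x ∂(vol Ω)

theorem memLp_testFunction {d : ℕ} {Ω : Opens (Space d)} (φ : TestFunction Ω ℝ ⊤) :
    MemLp φ 2 (vol Ω) :=
  (φ.continuous.memLp_of_hasCompactSupport φ.hasCompactSupport).restrict _

theorem memLp_fderiv_testFunction {d : ℕ} {Ω : Opens (Space d)} (φ : TestFunction Ω ℝ ⊤)
    (e : Space d) : MemLp (fun x => fderiv ℝ φ x e) 2 (vol Ω) := by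
  have h1 : Continuous (fun x => fderiv ℝ φ x e) :=
    (φ.contDiff.continuous_fderiv (by simp)).clm_apply continuous_const
  exact (h1.memLp_of_hasCompactSupport (φ.hasCompactSupport.fderiv_apply ℝ e)).restrict _

theorem memLp_coord {d : ℕ} {Ω : Opens (Space d)} (g : L2Vec Ω) (i : Fin d) :
    MemLp (fun x => g x i) 2 (vol Ω) :=
  (EuclideanSpace.proj (𝕜 := ℝ) i).comp_memLp' (Lp.memLp g)

/-- The Sobolev space `H¹(Ω)`: functions in `L²(Ω)` with a weak gradient in `L²(Ω)^d`. An element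
is stored as the pair (function, weak gradient), with the Hilbert norm of the pair; the weak
gradient is determined by the function. -/
def H1 {d : ℕ} (Ω : Opens (Space d)) : Submodule ℝ (WithLp 2 (L2 Ω × L2Vec Ω)) where
  carrier := {p | IsWeakGradient p.fst p.snd}
  zero_mem' := by
    intro φ i
    have h1 : (fun x => (0 : L2 Ω) x * fderiv ℝ φ x (EuclideanSpace.single i 1))
        =ᵐ[vol Ω] fun _ => 0 := by
      filter_upwards [Lp.coeFn_zero ℝ 2 (vol Ω)] with x hx
      rw [hx, Pi.zero_apply, zero_mul]
    have h2 : (fun x => (0 : L2Vec Ω) x i * φ x) =ᵐ[vol Ω] fun _ => 0 := by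
      filter_upwards [Lp.coeFn_zero (Space d) 2 (vol Ω)] with x hx
      rw [hx, Pi.zero_apply, PiLp.zero_apply, zero_mul]
    rw [WithLp.zero_fst, WithLp.zero_snd, integral_congr_ae h1, integral_congr_ae h2]
    simp
  add_mem' := by
    intro p q hp hq φ i
    have h1 : (fun x => (p.fst + q.fst : L2 Ω) x * fderiv ℝ φ x (EuclideanSpace.single i 1))
        =ᵐ[vol Ω] fun x => p.fst x * fderiv ℝ φ x (EuclideanSpace.single i 1)
          + q.fst x * fderiv ℝ φ x (EuclideanSpace.single i 1) := by
      filter_upwards [Lp.coeFn_add p.fst q.fst] with x hx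
      rw [hx, Pi.add_apply, add_mul]
    have h2 : (fun x => (p.snd + q.snd : L2Vec Ω) x i * φ x) =ᵐ[vol Ω]
        fun x => p.snd x i * φ x + q.snd x i * φ x := by
      filter_upwards [Lp.coeFn_add p.snd q.snd] with x hx
      rw [hx, Pi.add_apply, PiLp.add_apply, add_mul]
    have h3 := integral_add
      ((Lp.memLp p.fst).integrable_mul (memLp_fderiv_testFunction φ (EuclideanSpace.single i 1)))
      ((Lp.memLp q.fst).integrable_mul (memLp_fderiv_testFunction φ (EuclideanSpace.single i 1)))
    have h4 := integral_add ((memLp_coord p.snd i).integrable_mul (memLp_testFunction φ))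
      ((memLp_coord q.snd i).integrable_mul (memLp_testFunction φ))
    simp only [Pi.mul_apply] at h3 h4
    rw [WithLp.add_fst, WithLp.add_snd, integral_congr_ae h1, integral_congr_ae h2, h3, h4,
      hp φ i, hq φ i]
    ring
  smul_mem' := by
    intro c p hp φ i
    have h1 : (fun x => (c • p.fst : L2 Ω) x * fderiv ℝ φ x (EuclideanSpace.single i 1))
        =ᵐ[vol Ω] fun x => c * (p.fst x * fderiv ℝ φ x (EuclideanSpace.single i 1)) := by
      filter_upwards [Lp.coeFn_smul c p.fst] with x hx
      simp [hx, mul_assoc]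
    have h2 : (fun x => (c • p.snd : L2Vec Ω) x i * φ x) =ᵐ[vol Ω]
        fun x => c * (p.snd x i * φ x) := by
      filter_upwards [Lp.coeFn_smul c p.snd] with x hx
      simp [hx, mul_assoc]
    rw [WithLp.smul_fst, WithLp.smul_snd, integral_congr_ae h1, integral_congr_ae h2,
      integral_const_mul, integral_const_mul, hp φ i]
    ring

/-- The elements of `H¹(Ω)` that are represented by a function in `C_c^∞(Ω)`. -/
def testH1 {d : ℕ} (Ω : Opens (Space d)) : Submodule ℝ (H1 Ω) where
  carrier := {v | ∃ φ : TestFunction Ω ℝ ⊤, v.1.fst =ᵐ[vol Ω] φ}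
  zero_mem' := ⟨0, by
    exact Lp.coeFn_zero ℝ 2 (vol Ω)⟩
  add_mem' := by
    rintro v w ⟨φ, hφ⟩ ⟨ψ, hψ⟩
    refine ⟨φ + ψ, ?_⟩
    filter_upwards [hφ, hψ, Lp.coeFn_add v.1.fst w.1.fst] with x h1 h2 h3
    exact h3.trans (congrArg₂ (· + ·) h1 h2)
  smul_mem' := by
    rintro c v ⟨φ, hφ⟩
    refine ⟨c • φ, ?_⟩
    filter_upwards [hφ, Lp.coeFn_smul c v.1.fst] with x h1 h2
    simp [h1, h2]

/-- `H¹₀(Ω)`: the closure of `C_c^∞(Ω)` in `H¹(Ω)`. -/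
def H10 {d : ℕ} (Ω : Opens (Space d)) : Submodule ℝ (H1 Ω) := (testH1 Ω).topologicalClosure

/-- The embedding of `H¹₀(Ω)` into `L²(Ω)`. -/
def fn {d : ℕ} {Ω : Opens (Space d)} (v : H10 Ω) : L2 Ω := v.1.1.fst

/-- The weak gradient of `v ∈ H¹₀(Ω)`. -/
def grad {d : ℕ} {Ω : Opens (Space d)} (v : H10 Ω) : L2Vec Ω := v.1.1.snd

/-- The norm `(lam ‖∇v‖² + ‖v‖²)^(1/2)` on `H¹₀(Ω)`. -/
def lamNorm {d : ℕ} {Ω : Opens (Space d)} (lam : ℝ) (v : H10 Ω) : ℝ :=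
  Real.sqrt (lam * ‖grad v‖ ^ 2 + ‖fn v‖ ^ 2)

/-- The Poincaré constant of `Ω`: the best constant `C` in `‖v‖² ≤ C ‖∇v‖²`, `v ∈ H¹₀(Ω)`. -/
def poincareConst {d : ℕ} (Ω : Opens (Space d)) : ℝ :=
  sInf {C : ℝ | 0 < C ∧ ∀ v : H10 Ω, ‖fn v‖ ^ 2 ≤ C * ‖grad v‖ ^ 2}

/-- `σ_f(lam) = ess sup_{x ∈ Ω} sup_{u ∈ ℝ} |∂f/∂u (x,u) + 1/lam|`, with values in `[0,∞]`. -/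
def sigma {d : ℕ} (Ω : Opens (Space d)) (f : Space d → ℝ → ℝ) (lam : ℝ) : ℝ≥0∞ :=
  essSup (fun x => ⨆ u : ℝ, ENNReal.ofReal |deriv (f x) u + 1 / lam|) (vol Ω)

/-- `Λ_f(ρ) = {lam > 0 : σ_f(lam) < ρ + 1/lam}`. -/
def Lambda {d : ℕ} (Ω : Opens (Space d)) (f : Space d → ℝ → ℝ) (ρ : ℝ) : Set ℝ :=
  {lam | 0 < lam ∧ sigma Ω f lam < ENNReal.ofReal (ρ + 1 / lam)}

/-- The structural assumptions on the nonlinearity `f`. -/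
structure Admissible {d : ℕ} (Ω : Opens (Space d)) (f : Space d → ℝ → ℝ) (ρ : ℝ) : Prop where
  measurable : ∀ t : ℝ, AEStronglyMeasurable (fun x => f x t) (vol Ω)
  memLp_zero : MemLp (fun x => f x 0) 2 (vol Ω)
  differentiable : ∀ x ∈ Ω, Differentiable ℝ (f x)
  nonempty : (Lambda Ω f ρ).Nonempty

open Classical in
/-- `μ_f = 1 / sup Λ_f(ρ)` if the supremum is finite, and `0` otherwise. -/
def mu {d : ℕ} (Ω : Opens (Space d)) (f : Space d → ℝ → ℝ) (ρ : ℝ) : ℝ :=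
  if BddAbove (Lambda Ω f ρ) then (sSup (Lambda Ω f ρ))⁻¹ else 0

/-- `κ_f = max {μ_f + ρ/2 - 1/(2 C_P), 0}`. -/
def kappa {d : ℕ} (Ω : Opens (Space d)) (f : Space d → ℝ → ℝ) (ρ : ℝ) : ℝ :=
  max (mu Ω f ρ + ρ / 2 - 1 / (2 * poincareConst Ω)) 0

/-- The energy `E(v) = 1/2 ∫_Ω |∇v|² - ∫_Ω F(x,v(x)) dx` with `F(x,t) = ∫_0^t f(x,s) ds`. -/
def energy {d : ℕ} {Ω : Opens (Space d)} (f : Space d → ℝ → ℝ) (v : H10 Ω) : ℝ :=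
  1 / 2 * (∫ x, ‖grad v x‖ ^ 2 ∂(vol Ω)) - ∫ x, (∫ s in (0 : ℝ)..(fn v x), f x s) ∂(vol Ω)

/-- Weak coercivity: `E(v) → +∞` whenever `lamNorm lam v → ∞`. -/
def WeaklyCoercive {d : ℕ} (Ω : Opens (Space d)) (f : Space d → ℝ → ℝ) (lam : ℝ) : Prop :=
  Tendsto (fun v : H10 Ω => energy f v) (comap (fun v : H10 Ω => lamNorm lam v) atTop) atTop

/-- `B_lam(u,v) = ∫_Ω (lam ∇u·∇v + u v)`. -/
def formB {d : ℕ} {Ω : Opens (Space d)} (lam : ℝ) (u v : H10 Ω) : ℝ :=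
  ∫ x, (lam * inner ℝ (grad u x) (grad v x) + fn u x * fn v x) ∂(vol Ω)

/-- `ℓ_lam(y;v) = ∫_Ω (y + lam f(x,y)) v` for `y ∈ L²(Ω)`. -/
def formL {d : ℕ} {Ω : Opens (Space d)} (f : Space d → ℝ → ℝ) (lam : ℝ) (y : L2 Ω)
    (v : H10 Ω) : ℝ :=
  ∫ x, (y x + lam * f x (y x)) * fn v x ∂(vol Ω)

/-- `(uⁿ)_{n ≥ 0}` is generated by the iteration in `W` with time step `dt`: `u⁰ ∈ L²(Ω)` is
arbitrary, and `uⁿ⁺¹ ∈ W` satisfies `B_dt(uⁿ⁺¹,v) = ℓ_dt(uⁿ;v)` for all `v ∈ W`. -/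
def IsIteration {d : ℕ} {Ω : Opens (Space d)} (f : Space d → ℝ → ℝ)
    (W : Submodule ℝ (H10 Ω)) (dt : ℝ) (u : ℕ → L2 Ω) : Prop :=
  ∀ n : ℕ, ∃ w ∈ W, fn w = u (n + 1) ∧ ∀ v ∈ W, formB dt w v = formL f dt (u n) v

/-- `u ∈ W` solves the Galerkin problem `∫_Ω ∇u·∇v = ∫_Ω f(x,u) v` for all `v ∈ W`. -/
def IsGalerkinSolution {d : ℕ} {Ω : Opens (Space d)} (f : Space d → ℝ → ℝ)
    (W : Submodule ℝ (H10 Ω)) (u : H10 Ω) : Prop :=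
  u ∈ W ∧ ∀ v ∈ W,
    ∫ x, inner ℝ (grad u x) (grad v x) ∂(vol Ω) = ∫ x, f x (fn u x) * fn v x ∂(vol Ω)

end SemilinearGalerkin

end

open SemilinearGalerkin

/-! For `l` in `Lambda Ω f ρ` the bound on the shifted derivative makes `f` Lipschitz in its second
variable with constant `ρ + 2 / l`. The operator `u ↦ f(·,u)` is therefore Lipschitz on `L²(Ω)`, and
its potential differs from its first-order Taylor polynomial by at most `(ρ + 2 / l) / 2` times the
squared distance (`Admissible.exists_nemytskii`).

Testing the scheme with the increment `w - y` gives `E(w) + γ ‖w - y‖² ≤ E(y)` with `γ = 1/dt - ρ/2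
- 1/l + 1/(2 C_P)`, the last term coming from Poincaré (`energy_step_le`). The step-size condition
is exactly what allows an `l` with `γ > 0` (`exists_mem_Lambda_of_kappa_lt`). Coercivity then bounds
the iterates, the energies are bounded below along them, and the increments tend to zero in `L²`.

A bounded sequence in the closed subspace `W` has a weakly convergent subsequence, which converges
strongly in `L²` by Rellich (`tendsto_fn_zero`). Since increments vanish, the preceding iterates
share that limit, and both sides of the scheme pass to the limit. Rellich is obtained by comparing
functions with their averages over small balls: the error is at most `ε ‖∇v‖`, and averaging turns
weak into strong convergence. -/

namespace SemilinearGalerkin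

/-! ### Translation and ball-average estimates on the whole space. -/

section Translation

theorem sq_lintegral_le_lintegral_sq {α : Type*} [MeasurableSpace α] {μ : Measure α}
    [IsProbabilityMeasure μ] {g : α → ℝ≥0∞} (hg : AEMeasurable g μ) :
    (∫⁻ a, g a ∂μ) ^ 2 ≤ ∫⁻ a, g a ^ 2 ∂μ := by
  have h := ENNReal.lintegral_mul_le_Lp_mul_Lq μ Real.HolderConjugate.two_two hg
    (aemeasurable_const (b := (1 : ℝ≥0∞)))
  simp only [Pi.mul_apply, mul_one, ENNReal.one_rpow, lintegral_const, measure_univ] at h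
  calc (∫⁻ a, g a ∂μ) ^ 2 ≤ ((∫⁻ a, g a ^ (2 : ℝ) ∂μ) ^ (1 / (2 : ℝ))) ^ 2 := by gcongr
    _ = ∫⁻ a, g a ^ 2 ∂μ := by
        rw [← ENNReal.rpow_natCast, ← ENNReal.rpow_mul]
        norm_num

/-- Fundamental theorem of calculus along the segment from `x` to `x + h`, then Cauchy–Schwarz in
`t`. -/
theorem enorm_translate_sub_sq_le {E : Type*} [NormedAddCommGroup E] [NormedSpace ℝ E] {φ : E → ℝ} (hφ : ContDiff ℝ 1 φ) (x h : E) :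
    ‖φ (x + h) - φ x‖ₑ ^ 2
      ≤ ‖h‖ₑ ^ 2 * ∫⁻ t in Set.Icc (0 : ℝ) 1, ‖fderiv ℝ φ (x + t • h)‖ₑ ^ 2 := by
  have hγ : ∀ t : ℝ, HasDerivAt (fun t : ℝ => φ (x + t • h)) (fderiv ℝ φ (x + t • h) h) t := by
    intro t
    have h1 : HasDerivAt (fun t : ℝ => x + t • h) h t := by
      simpa using ((hasDerivAt_id t).smul_const h).const_add x
    exact ((hφ.differentiable (by simp)) _).hasFDerivAt.comp_hasDerivAt t h1
  have hc : Continuous fun t : ℝ => fderiv ℝ φ (x + t • h) :=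
    (hφ.continuous_fderiv (by simp)).comp (by fun_prop)
  have hcd : ContDiffOn ℝ 1 (fun t : ℝ => φ (x + t • h)) (Set.Icc 0 1) :=
    (hφ.comp (by fun_prop : ContDiff ℝ 1 fun t : ℝ => x + t • h)).contDiffOn
  have h1 := enorm_sub_le_lintegral_deriv_of_contDiffOn_Icc hcd zero_le_one
  simp only [one_smul, zero_smul, add_zero] at h1
  have : IsProbabilityMeasure ((volume : Measure ℝ).restrict (Set.Icc 0 1)) := ⟨by simp⟩
  calc ‖φ (x + h) - φ x‖ₑ ^ 2
      ≤ (∫⁻ t in Set.Icc (0 : ℝ) 1, ‖fderiv ℝ φ (x + t • h)‖ₑ * ‖h‖ₑ) ^ 2 := by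
        gcongr
        refine h1.trans (lintegral_mono fun t => ?_)
        rw [(hγ t).deriv]
        exact ContinuousLinearMap.le_opENorm _ _
    _ ≤ ∫⁻ t in Set.Icc (0 : ℝ) 1, (‖fderiv ℝ φ (x + t • h)‖ₑ * ‖h‖ₑ) ^ 2 :=
        sq_lintegral_le_lintegral_sq (hc.enorm.aemeasurable.mul_const _)
    _ = _ := by
        simp_rw [mul_pow]
        rw [lintegral_mul_const _ (hc.enorm.measurable.pow_const 2), mul_comm]

variable {E : Type*} [NormedAddCommGroup E] [NormedSpace ℝ E] [FiniteDimensional ℝ E]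
  [MeasurableSpace E] [BorelSpace E] {μ : Measure E} [μ.IsAddHaarMeasure]

/-- After Tonelli, translation invariance of `μ` makes the inner integral independent of `t`. -/
theorem lintegral_translate_sub_sq_le {φ : E → ℝ} (hφ : ContDiff ℝ 1 φ) (h : E) :
    ∫⁻ x, ‖φ (x + h) - φ x‖ₑ ^ 2 ∂μ ≤ ‖h‖ₑ ^ 2 * ∫⁻ x, ‖fderiv ℝ φ x‖ₑ ^ 2 ∂μ := by
  have hc : Continuous (fderiv ℝ φ) := hφ.continuous_fderiv (by simp)
  have hm : Measurable fun p : E × ℝ => ‖fderiv ℝ φ (p.1 + p.2 • h)‖ₑ ^ 2 := by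
    have : Continuous fun p : E × ℝ => ‖fderiv ℝ φ (p.1 + p.2 • h)‖ₑ ^ 2 := by fun_prop
    exact this.measurable
  calc ∫⁻ x, ‖φ (x + h) - φ x‖ₑ ^ 2 ∂μ
      ≤ ∫⁻ x, ‖h‖ₑ ^ 2 * (∫⁻ t in Set.Icc (0 : ℝ) 1, ‖fderiv ℝ φ (x + t • h)‖ₑ ^ 2) ∂μ :=
        lintegral_mono fun x => enorm_translate_sub_sq_le hφ x h
    _ = ‖h‖ₑ ^ 2 * ∫⁻ x, (∫⁻ t in Set.Icc (0 : ℝ) 1, ‖fderiv ℝ φ (x + t • h)‖ₑ ^ 2) ∂μ :=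
        lintegral_const_mul _ hm.lintegral_prod_right'
    _ = ‖h‖ₑ ^ 2 * ∫⁻ t : ℝ in Set.Icc 0 1, ∫⁻ x, ‖fderiv ℝ φ (x + t • h)‖ₑ ^ 2 ∂μ := by
        rw [lintegral_lintegral_swap hm.aemeasurable]
    _ = _ := by
        congr 1
        simp_rw [lintegral_add_right_eq_self (μ := μ) (fun x => ‖fderiv ℝ φ x‖ₑ ^ 2)]
        simp

/-- A function is `ε`-close in `L²`, relative to its gradient, to its averages over `ε`-balls. -/
theorem lintegral_sub_ballAverage_sq_le {φ : E → ℝ} (hφ : ContDiff ℝ 1 φ) {ε : ℝ} (hε : 0 < ε) :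
    ∫⁻ x, ‖φ x - (μ.real (Metric.ball (0 : E) ε))⁻¹ * ∫ y in Metric.ball x ε, φ y ∂μ‖ₑ ^ 2 ∂μ
      ≤ ENNReal.ofReal ε ^ 2 * ∫⁻ x, ‖fderiv ℝ φ x‖ₑ ^ 2 ∂μ := by
  set B := Metric.ball (0 : E) ε
  -- Normalising to a probability measure turns the average into an expectation, to which
  -- Cauchy–Schwarz applies with constant one.
  set ν : Measure E := (μ B)⁻¹ • μ.restrict B with hν
  have hB0 : μ B ≠ 0 := (Metric.measure_ball_pos μ 0 hε).ne'
  have hBt : μ B ≠ ∞ := measure_ball_lt_top.ne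
  have hprob : IsProbabilityMeasure ν :=
    ⟨by simp [hν, ENNReal.inv_mul_cancel hB0 hBt]⟩
  have hc : Continuous φ := hφ.continuous
  have havg : ∀ x, (μ.real B)⁻¹ * ∫ y in Metric.ball x ε, φ y ∂μ = ∫ h, φ (x + h) ∂ν := by
    intro x
    rw [hν, integral_smul_measure, ENNReal.toReal_inv, smul_eq_mul]
    congr 1
    rw [← integral_indicator Metric.isOpen_ball.measurableSet,
      ← integral_indicator Metric.isOpen_ball.measurableSet,
      ← integral_add_left_eq_self (μ := μ) _ x]
    congr 1
    ext h
    simp only [Set.indicator, Metric.mem_ball, dist_self_add_left, dist_zero_right]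
  have hint : ∀ x, Integrable (fun h => φ (x + h)) ν := by
    intro x
    refine Integrable.smul_measure ?_ (ENNReal.inv_ne_top.2 hB0)
    have : IntegrableOn (fun h => φ (x + h)) (Metric.closedBall 0 ε) μ :=
      (by fun_prop : Continuous fun h => φ (x + h)).continuousOn.integrableOn_compact
        (isCompact_closedBall 0 ε)
    exact this.mono_set Metric.ball_subset_closedBall
  have hpt : ∀ x, ‖φ x - ∫ h, φ (x + h) ∂ν‖ₑ ^ 2 ≤ ∫⁻ h, ‖φ (x + h) - φ x‖ₑ ^ 2 ∂ν := by
    intro x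
    have : φ x - ∫ h, φ (x + h) ∂ν = ∫ h, (φ x - φ (x + h)) ∂ν := by
      rw [integral_sub (integrable_const _) (hint x)]
      simp
    rw [this]
    calc _ ≤ (∫⁻ h, ‖φ x - φ (x + h)‖ₑ ∂ν) ^ 2 := by
          gcongr
          exact enorm_integral_le_lintegral_enorm _
      _ ≤ ∫⁻ h, ‖φ x - φ (x + h)‖ₑ ^ 2 ∂ν :=
          sq_lintegral_le_lintegral_sq (by fun_prop)
      _ = _ := by simp_rw [enorm_sub_rev]
  have hm : Measurable fun p : E × E => ‖φ (p.1 + p.2) - φ p.1‖ₑ ^ 2 := by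
    have : Continuous fun p : E × E => ‖φ (p.1 + p.2) - φ p.1‖ₑ ^ 2 := by fun_prop
    exact this.measurable
  simp_rw [havg]
  calc _ ≤ ∫⁻ x, ∫⁻ h, ‖φ (x + h) - φ x‖ₑ ^ 2 ∂ν ∂μ := lintegral_mono hpt
    _ = ∫⁻ h, ∫⁻ x, ‖φ (x + h) - φ x‖ₑ ^ 2 ∂μ ∂ν := lintegral_lintegral_swap hm.aemeasurable
    _ ≤ ∫⁻ h, ENNReal.ofReal ε ^ 2 * ∫⁻ x, ‖fderiv ℝ φ x‖ₑ ^ 2 ∂μ ∂ν := by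
        refine lintegral_mono_ae ?_
        refine Measure.ae_smul_measure ?_ _
        filter_upwards [ae_restrict_mem Metric.isOpen_ball.measurableSet] with h hh
        refine (lintegral_translate_sub_sq_le hφ h).trans ?_
        gcongr
        rw [← ofReal_norm]
        exact ENNReal.ofReal_le_ofReal (mem_ball_zero_iff.1 hh).le
    _ = _ := by simp

end Translation

/-! ### Rellich compactness of `H¹₀(Ω)` in `L²(Ω)`. -/

section Rellich

theorem Lp_enorm_sq {α F : Type*} [MeasurableSpace α] {μ : Measure α} [NormedAddCommGroup F]
    (u : Lp F 2 μ) : ‖u‖ₑ ^ 2 = ∫⁻ x, ‖u x‖ₑ ^ 2 ∂μ := by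
  rw [Lp.enorm_def, eLpNorm_eq_lintegral_rpow_enorm_toReal (by simp) (by simp), ← ENNReal.rpow_natCast,
    ← ENNReal.rpow_mul]
  norm_num

variable {d : ℕ} {Ω : Opens (Space d)}

/-- Both sides satisfy the same integration by parts against every test function, so the fundamental
lemma of the calculus of variations identifies them. -/
theorem grad_eq_fderiv_of_testFunction {v : H1 Ω} {φ : TestFunction Ω ℝ ⊤}
    (hv : v.1.fst =ᵐ[vol Ω] φ) :
    ∀ᵐ x ∂(vol Ω), ∀ i, v.1.snd x i = fderiv ℝ φ x (EuclideanSpace.single i 1) := by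
  rw [ae_all_iff]
  intro i
  set e : Space d := EuclideanSpace.single i 1
  have hφ1 : ContDiff ℝ 1 φ := φ.contDiff.of_le (by simp)
  have hφd : Differentiable ℝ φ := hφ1.differentiable (by simp)
  have hφ' : Continuous fun x => fderiv ℝ φ x e :=
    (hφ1.continuous_fderiv (by simp)).clm_apply continuous_const
  have hloc : LocallyIntegrableOn (fun x => v.1.snd x i - fderiv ℝ φ x e) Ω := by
    refine locallyIntegrableOn_of_locallyIntegrable_restrict ?_
    exact ((memLp_coord v.1.snd i).sub (memLp_fderiv_testFunction φ e)).locallyIntegrable (by simp)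
  have key := Ω.isOpen.ae_eq_zero_of_integral_contDiff_smul_eq_zero hloc ?_
  · rw [ae_restrict_iff' Ω.isOpen.measurableSet]
    filter_upwards [key] with x hx hxΩ
    exact sub_eq_zero.1 (hx hxΩ)
  intro g hg hgc hgs
  let ψ : TestFunction Ω ℝ ⊤ := ⟨g, hg, hgc, hgs⟩
  have hψ : (ψ : Space d → ℝ) = g := rfl
  have hg1 : ContDiff ℝ 1 g := hg.of_le (by simp)
  have hgd : Differentiable ℝ g := hg1.differentiable (by simp)
  have hg' : Continuous fun x => fderiv ℝ g x e :=
    (hg1.continuous_fderiv (by simp)).clm_apply continuous_const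
  have hsupp : ∀ x ∉ (Ω : Set (Space d)), g x = 0 := fun x hx =>
    image_eq_zero_of_notMem_tsupport fun h => hx (hgs h)
  have hφsupp : ∀ x ∉ (Ω : Set (Space d)), φ x = 0 := fun x hx =>
    image_eq_zero_of_notMem_tsupport fun h => hx (φ.tsupport_subset h)
  have hweak := v.2 ψ i
  rw [hψ] at hweak
  have h1 : ∫ x, v.1.fst x * fderiv ℝ g x e ∂(vol Ω) = ∫ x, φ x * fderiv ℝ g x e := by
    rw [← setIntegral_eq_integral_of_forall_compl_eq_zero (s := Ω)
      (f := fun x => φ x * fderiv ℝ g x e) (fun x hx => by rw [hφsupp x hx, zero_mul])]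
    refine integral_congr_ae ?_
    filter_upwards [hv] with x hx
    rw [hx]
  have h2 : ∫ x, φ x * fderiv ℝ g x e = - ∫ x, fderiv ℝ φ x e * g x := by
    refine integral_mul_fderiv_eq_neg_fderiv_mul_of_integrable ?_ ?_ ?_
      (fun x _ => hφd x) (fun x _ => hgd x)
    · exact (hφ'.mul hg.continuous).integrable_of_hasCompactSupport hgc.mul_left
    · exact (φ.continuous.mul hg').integrable_of_hasCompactSupport φ.hasCompactSupport.mul_right
    · exact (φ.continuous.mul hg.continuous).integrable_of_hasCompactSupport hgc.mul_left
  have h3 : ∫ x, fderiv ℝ φ x e * g x = ∫ x, fderiv ℝ φ x e * g x ∂(vol Ω) := by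
    rw [setIntegral_eq_integral_of_forall_compl_eq_zero]
    intro x hx
    rw [hsupp x hx, mul_zero]
  rw [← setIntegral_eq_integral_of_forall_compl_eq_zero (s := Ω)
    (fun x hx => by rw [hsupp x hx, zero_smul])]
  have h4 := integral_sub ((memLp_coord v.1.snd i).integrable_mul (memLp_testFunction ψ))
    ((memLp_fderiv_testFunction φ e).integrable_mul (memLp_testFunction ψ))
  simp only [Pi.mul_apply, hψ] at h4
  calc ∫ x in Ω, g x • (v.1.snd x i - fderiv ℝ φ x e)
      = ∫ x, v.1.snd x i * g x - fderiv ℝ φ x e * g x ∂(vol Ω) := by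
        congr 1; ext x; simp only [smul_eq_mul]; ring
    _ = 0 := by
        rw [h4, ← h3]
        linarith [h1.symm.trans hweak]

/-- The derivative vanishes off `Ω`; on `Ω` it is the inner product with the weak gradient, which
bounds its operator norm. -/
theorem enorm_fderiv_le_grad {v : H1 Ω} {φ : TestFunction Ω ℝ ⊤} (hv : v.1.fst =ᵐ[vol Ω] φ) :
    ∫⁻ x, ‖fderiv ℝ φ x‖ₑ ^ 2 ≤ ‖v.1.snd‖ₑ ^ 2 := by
  have h0 : ∀ x ∉ (Ω : Set (Space d)), fderiv ℝ φ x = 0 := fun x hx =>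
    image_eq_zero_of_notMem_tsupport fun h => hx (φ.tsupport_subset (tsupport_fderiv_subset ℝ h))
  have h1 : ∫⁻ x, ‖fderiv ℝ φ x‖ₑ ^ 2 = ∫⁻ x in Ω, ‖fderiv ℝ φ x‖ₑ ^ 2 := by
    rw [← lintegral_indicator Ω.isOpen.measurableSet]
    congr 1
    ext x
    by_cases hx : x ∈ (Ω : Set (Space d))
    · rw [Set.indicator_of_mem hx]
    · rw [Set.indicator_of_notMem hx, ← ofReal_norm, h0 x hx, norm_zero, ENNReal.ofReal_zero, zero_pow two_ne_zero]
  rw [h1, Lp_enorm_sq]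
  refine lintegral_mono_ae ?_
  filter_upwards [grad_eq_fderiv_of_testFunction hv] with x hx
  gcongr
  rw [← ofReal_norm, ← ofReal_norm]
  refine ENNReal.ofReal_le_ofReal (ContinuousLinearMap.opNorm_le_bound _ (norm_nonneg _) fun h => ?_)
  have : fderiv ℝ φ x h = inner ℝ (v.1.snd x) h := by
    conv_lhs => rw [← (EuclideanSpace.basisFun (Fin d) ℝ).sum_repr h]
    rw [map_sum, PiLp.inner_apply]
    refine Finset.sum_congr rfl fun i _ => ?_
    rw [map_smul, EuclideanSpace.basisFun_apply, ← hx i]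
    simp
  rw [this]
  exact norm_inner_le_norm _ _

/-- The average of `u`, extended by zero, over the ball of radius `ε` about `x`. -/
noncomputable def ballAverage (ε : ℝ) (u : L2 Ω) (x : Space d) : ℝ :=
  ((volume : Measure (Space d)).real (Metric.ball 0 ε))⁻¹ *
    -- As an inner product with a fixed `L²` function, the average is linear in `u`, bounded by
    -- Cauchy–Schwarz, and convergent at each `x` along weakly convergent sequences.
    inner ℝ (indicatorConstLp (E := ℝ) (μ := vol Ω) 2 (Metric.isOpen_ball (x := x) (ε := ε)).measurableSet
      measure_ball_lt_top.ne (1 : ℝ)) u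

theorem ballAverage_eq (ε : ℝ) (u : L2 Ω) (x : Space d) :
    ballAverage ε u x = ((volume : Measure (Space d)).real (Metric.ball 0 ε))⁻¹ *
      ∫ y in Metric.ball x ε, u y ∂(vol Ω) := by
  rw [ballAverage, L2.inner_indicatorConstLp_one]

theorem abs_ballAverage_le [IsFiniteMeasure (vol Ω)] (ε : ℝ) (u : L2 Ω) (x : Space d) :
    |ballAverage ε u x| ≤ ((volume : Measure (Space d)).real (Metric.ball 0 ε))⁻¹ *
      ((vol Ω).real Set.univ ^ (1 / 2 : ℝ) * ‖u‖) := by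
  rw [ballAverage, abs_mul, abs_of_nonneg (inv_nonneg.2 measureReal_nonneg)]
  gcongr
  refine (abs_real_inner_le_norm _ _).trans ?_
  gcongr
  rw [norm_indicatorConstLp (by simp) (by simp)]
  simp only [norm_one, one_mul, ENNReal.toReal_ofNat]
  exact Real.rpow_le_rpow measureReal_nonneg (measureReal_mono (Set.subset_univ _)) (by simp)

theorem aestronglyMeasurable_ballAverage (ε : ℝ) (u : L2 Ω) :
    AEStronglyMeasurable (ballAverage ε u) (vol Ω) := by
  refine StronglyMeasurable.aestronglyMeasurable ?_
  -- The moving domain becomes a jointly measurable indicator, so measurability of parametric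
  -- integrals applies.
  have h1 : ballAverage ε u = fun x => ((volume : Measure (Space d)).real (Metric.ball 0 ε))⁻¹ *
      ∫ y, {p : Space d × Space d | dist p.2 p.1 < ε}.indicator (fun p => u p.2) (x, y) ∂(vol Ω) := by
    ext x
    rw [ballAverage_eq, ← integral_indicator Metric.isOpen_ball.measurableSet]
    rfl
  rw [h1]
  refine StronglyMeasurable.const_mul (StronglyMeasurable.integral_prod_right' ?_) _
  refine StronglyMeasurable.indicator ?_
    (measurableSet_lt (by fun_prop) measurable_const)
  exact (Lp.stronglyMeasurable u).comp_measurable measurable_snd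

theorem memLp_ballAverage [IsFiniteMeasure (vol Ω)] (ε : ℝ) (u : L2 Ω) :
    MemLp (ballAverage ε u) 2 (vol Ω) :=
  MemLp.of_bound (aestronglyMeasurable_ballAverage ε u) _
    (Eventually.of_forall fun x => abs_ballAverage_le ε u x)

/-- Averaging over balls of radius `ε` as an operator on `L²(Ω)`. -/
noncomputable def ballAverageL [IsFiniteMeasure (vol Ω)] (ε : ℝ) : L2 Ω →L[ℝ] L2 Ω :=
  LinearMap.mkContinuous
    { toFun := fun u => (memLp_ballAverage ε u).toLp
      map_add' := fun u v => by
        rw [← MemLp.toLp_add]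
        congr 1
        ext x
        simp only [ballAverage, inner_add_right, mul_add, Pi.add_apply]
      map_smul' := fun c u => by
        rw [RingHom.id_apply, ← MemLp.toLp_const_smul]
        congr 1
        ext x
        simp only [ballAverage, inner_smul_right, Pi.smul_apply, smul_eq_mul]
        ring }
    ((vol Ω).real Set.univ ^ (1 / 2 : ℝ) *
      (((volume : Measure (Space d)).real (Metric.ball 0 ε))⁻¹ *
        (vol Ω).real Set.univ ^ (1 / 2 : ℝ)))
    (fun u => by
      have := Lp.norm_le_of_ae_bound (p := 2) (f := (memLp_ballAverage ε u).toLp)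
        (C := ((volume : Measure (Space d)).real (Metric.ball 0 ε))⁻¹ *
          ((vol Ω).real Set.univ ^ (1 / 2 : ℝ) * ‖u‖)) (by positivity) (by
          filter_upwards [(memLp_ballAverage ε u).coeFn_toLp] with x hx
          rw [hx]
          exact abs_ballAverage_le ε u x)
      have h1 : ((measureUnivNNReal (vol Ω) : ℝ)) = (vol Ω).real Set.univ := rfl
      rw [h1, ENNReal.toReal_ofNat, ← one_div] at this
      exact this.trans (le_of_eq (by ring)))

theorem coeFn_ballAverageL [IsFiniteMeasure (vol Ω)] (ε : ℝ) (u : L2 Ω) :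
    ballAverageL ε u =ᵐ[vol Ω] ballAverage ε u :=
  (memLp_ballAverage ε u).coeFn_toLp

/-- Both sides are continuous on `H¹(Ω)`, so test functions suffice. These extend by zero to smooth
functions on `ℝ^d`, where the whole-space estimate applies; no regularity of the boundary is needed.
-/
theorem norm_fst_sub_ballAverageL_le [IsFiniteMeasure (vol Ω)] {ε : ℝ} (hε : 0 < ε) (v : H10 Ω) :
    ‖fn v - ballAverageL ε (fn v)‖ ≤ ε * ‖grad v‖ := by
  have hclosed : IsClosed {v : H1 Ω | ‖v.1.fst - ballAverageL ε v.1.fst‖ ≤ ε * ‖v.1.snd‖} := by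
    have h1 : Continuous fun v : H1 Ω => v.1.fst :=
      (WithLp.fstL 2 ℝ _ _).continuous.comp continuous_subtype_val
    have h2 : Continuous fun v : H1 Ω => v.1.snd :=
      (WithLp.sndL 2 ℝ _ _).continuous.comp continuous_subtype_val
    exact isClosed_le (h1.sub ((ballAverageL ε).continuous.comp h1)).norm
      (continuous_const.mul h2.norm)
  refine closure_minimal (s := (testH1 Ω : Set (H1 Ω))) ?_ hclosed v.2
  rintro v ⟨φ, hφ⟩
  have hφ1 : ContDiff ℝ 1 φ := φ.contDiff.of_le (by simp)
  have hφsupp : ∀ x ∉ (Ω : Set (Space d)), φ x = 0 := fun x hx =>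
    image_eq_zero_of_notMem_tsupport fun h => hx (φ.tsupport_subset h)
  have havg : ∀ x, ballAverage ε v.1.fst x = ((volume : Measure (Space d)).real (Metric.ball 0 ε))⁻¹ *
      ∫ y in Metric.ball x ε, φ y := by
    intro x
    rw [ballAverage_eq, integral_congr_ae (ae_restrict_of_ae hφ),
      Measure.restrict_restrict Metric.isOpen_ball.measurableSet, Set.inter_comm,
      ← Measure.restrict_restrict Ω.isOpen.measurableSet,
      setIntegral_eq_integral_of_forall_compl_eq_zero hφsupp]
  have key : ‖v.1.fst - ballAverageL ε v.1.fst‖ₑ ^ 2 ≤ (ENNReal.ofReal ε * ‖v.1.snd‖ₑ) ^ 2 := by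
    rw [Lp_enorm_sq, mul_pow]
    calc ∫⁻ x, ‖(v.1.fst - ballAverageL ε v.1.fst : L2 Ω) x‖ₑ ^ 2 ∂(vol Ω)
        = ∫⁻ x, ‖φ x - ((volume : Measure (Space d)).real (Metric.ball 0 ε))⁻¹ *
          ∫ y in Metric.ball x ε, φ y‖ₑ ^ 2 ∂(vol Ω) := by
          refine lintegral_congr_ae ?_
          filter_upwards [Lp.coeFn_sub v.1.fst (ballAverageL ε v.1.fst), hφ,
            coeFn_ballAverageL ε v.1.fst] with x h1 h2 h3
          rw [h1, Pi.sub_apply, h2, h3, havg]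
      _ ≤ _ := setLIntegral_le_lintegral _ _
      _ ≤ _ := lintegral_sub_ballAverage_sq_le hφ1 hε
      _ ≤ _ := by gcongr; exact enorm_fderiv_le_grad hφ
  have key2 := (ENNReal.pow_le_pow_left_iff two_ne_zero).1 key
  rw [← ofReal_norm, ← ofReal_norm, ← ENNReal.ofReal_mul hε.le] at key2
  exact (ENNReal.ofReal_le_ofReal_iff (by positivity)).1 key2

/-- Weak convergence gives pointwise convergence of the averages, which are uniformly bounded;
dominated convergence on a finite measure space does the rest. -/
theorem tendsto_ballAverageL_zero [IsFiniteMeasure (vol Ω)] (ε : ℝ) {u : ℕ → L2 Ω} {C : ℝ}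
    (hC : ∀ n, ‖u n‖ ≤ C) (hu : ∀ a : L2 Ω, Tendsto (fun n => inner ℝ a (u n)) atTop (𝓝 0)) :
    Tendsto (fun n => ballAverageL ε (u n)) atTop (𝓝 0) := by
  rw [tendsto_zero_iff_norm_tendsto_zero]
  have h : Tendsto (fun n => ‖ballAverageL ε (u n)‖ ^ 2) atTop (𝓝 0) := by
    have h1 : ∀ n, ‖ballAverageL ε (u n)‖ ^ 2 = ∫ x, ballAverage ε (u n) x ^ 2 ∂(vol Ω) := by
      intro n
      rw [← real_inner_self_eq_norm_sq, L2.inner_def]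
      refine integral_congr_ae ?_
      filter_upwards [coeFn_ballAverageL ε (u n)] with x hx
      rw [hx, real_inner_self_eq_norm_sq, Real.norm_eq_abs, sq_abs]
    simp_rw [h1]
    rw [← integral_zero (Space d) ℝ (μ := vol Ω)]
    refine tendsto_integral_of_dominated_convergence
      (fun _ => (((volume : Measure (Space d)).real (Metric.ball 0 ε))⁻¹ *
        ((vol Ω).real Set.univ ^ (1 / 2 : ℝ) * C)) ^ 2)
      (fun n => (aestronglyMeasurable_ballAverage ε (u n)).pow 2) (integrable_const _) ?_ ?_
    · intro n
      refine Eventually.of_forall fun x => ?_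
      rw [norm_pow]
      gcongr
      refine (abs_ballAverage_le ε (u n) x).trans ?_
      gcongr
      exact hC n
    · refine Eventually.of_forall fun x => ?_
      have := ((hu (indicatorConstLp (E := ℝ) (μ := vol Ω) 2
        (Metric.isOpen_ball (x := x) (ε := ε)).measurableSet measure_ball_lt_top.ne (1 : ℝ))).const_mul
        ((volume : Measure (Space d)).real (Metric.ball 0 ε))⁻¹).pow 2
      simpa [ballAverage] using this
  have h2 := h.sqrt
  simpa [Real.sqrt_sq (norm_nonneg _)] using h2

/-- **Rellich's theorem**: bounded sequences in `H¹₀(Ω)` that converge weakly to zero in `L²(Ω)`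
converge strongly in `L²(Ω)`. -/
theorem tendsto_fn_zero [IsFiniteMeasure (vol Ω)] {v : ℕ → H10 Ω} {C : ℝ}
    (hC : ∀ n, ‖fn (v n)‖ ≤ C) (hC' : ∀ n, ‖grad (v n)‖ ≤ C)
    (hv : ∀ a : L2 Ω, Tendsto (fun n => inner ℝ a (fn (v n))) atTop (𝓝 0)) :
    Tendsto (fun n => fn (v n)) atTop (𝓝 0) := by
  have hC0 : 0 ≤ C := (norm_nonneg _).trans (hC 0)
  rw [Metric.tendsto_atTop]
  intro η hη
  -- The averaging error is at most `ε * C ≤ η / 2`; `C + 1` avoids division by zero.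
  set ε := η / (2 * (C + 1))
  have hε : 0 < ε := by positivity
  have hεC : ε * C ≤ η / 2 := by
    have : ε * (C + 1) = η / 2 := by simp only [ε]; field_simp
    nlinarith
  obtain ⟨N, hN⟩ := (Metric.tendsto_atTop.1 (tendsto_ballAverageL_zero ε hC hv)) (η / 2) (by positivity)
  refine ⟨N, fun n hn => ?_⟩
  have h1 := hN n hn
  rw [dist_zero_right] at h1 ⊢
  calc ‖fn (v n)‖ = ‖(fn (v n) - ballAverageL ε (fn (v n))) + ballAverageL ε (fn (v n))‖ := by
        rw [sub_add_cancel]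
    _ ≤ ‖fn (v n) - ballAverageL ε (fn (v n))‖ + ‖ballAverageL ε (fn (v n))‖ := norm_add_le _ _
    _ < η / 2 + η / 2 := by
        refine add_lt_add_of_le_of_lt ?_ h1
        exact (norm_fst_sub_ballAverageL_le hε _).trans
          ((mul_le_mul_of_nonneg_left (hC' n) hε.le).trans hεC)
    _ = η := by ring

end Rellich

/-! ### Weak sequential compactness and the Hilbert structure of `H¹₀(Ω)`. -/

section Hilbert

/-- Bounded sequences in a separable Hilbert space have weakly convergent subsequences. -/
theorem exists_subseq_tendsto_weak {H : Type*} [NormedAddCommGroup H] [InnerProductSpace ℝ H]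
    [CompleteSpace H] [SeparableSpace H] {x : ℕ → H} {C : ℝ} (hx : ∀ n, ‖x n‖ ≤ C) :
    ∃ (ns : ℕ → ℕ) (y : H), StrictMono ns ∧
      ∀ ℓ : StrongDual ℝ H, Tendsto (fun k => ℓ (x (ns k))) atTop (𝓝 (ℓ y)) := by
  -- Through Riesz, weak convergence in `H` becomes weak-* convergence of functionals, and
  -- sequential Banach–Alaoglu applies.
  let X : ℕ → WeakDual ℝ H := fun n =>
    StrongDual.toWeakDual (InnerProductSpace.toDual ℝ H (x n))
  have hX : ∀ n, X n ∈ WeakDual.toStrongDual ⁻¹' Metric.closedBall (0 : StrongDual ℝ H) C := by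
    intro n
    change InnerProductSpace.toDual ℝ H (x n) ∈ Metric.closedBall (0 : StrongDual ℝ H) C
    rw [mem_closedBall_zero_iff, LinearIsometryEquiv.norm_map]
    exact hx n
  obtain ⟨z, -, ns, hns, hz⟩ := WeakDual.isSeqCompact_closedBall ℝ H 0 C hX
  rw [tendsto_iff_forall_eval_tendsto_topDualPairing] at hz
  refine ⟨ns, (InnerProductSpace.toDual ℝ H).symm (WeakDual.toStrongDual z), hns, fun ℓ => ?_⟩
  have h1 := hz ((InnerProductSpace.toDual ℝ H).symm ℓ)
  have h2 : ∀ w : H, ℓ w = inner ℝ w ((InnerProductSpace.toDual ℝ H).symm ℓ) := fun w => by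
    rw [real_inner_comm, InnerProductSpace.toDual_symm_apply]
  simp_rw [h2]
  rw [InnerProductSpace.toDual_symm_apply]
  exact h1

theorem exists_subseq_tendsto_weak_submodule {H : Type*} [NormedAddCommGroup H]
    [InnerProductSpace ℝ H] [CompleteSpace H] [SecondCountableTopology H] (W : Submodule ℝ H)
    (hW : IsClosed (W : Set H)) {x : ℕ → W} {C : ℝ} (hx : ∀ n, ‖(x n : H)‖ ≤ C) :
    ∃ (ns : ℕ → ℕ) (y : W), StrictMono ns ∧
      ∀ ℓ : StrongDual ℝ W, Tendsto (fun k => ℓ (x (ns k))) atTop (𝓝 (ℓ y)) :=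
  have : CompleteSpace W := hW.completeSpace_coe
  exists_subseq_tendsto_weak hx

variable {d : ℕ} {Ω : Opens (Space d)}

/-- Each instance of the weak gradient identity equates two `L²` inner products with fixed
functions, hence is a closed condition on the pair. -/
theorem isClosed_H1 : IsClosed (H1 Ω : Set (WithLp 2 (L2 Ω × L2Vec Ω))) := by
  have h : (H1 Ω : Set (WithLp 2 (L2 Ω × L2Vec Ω))) = ⋂ (φ : TestFunction Ω ℝ ⊤) (i : Fin d),
      {p | inner ℝ p.fst (memLp_fderiv_testFunction φ (EuclideanSpace.single i 1)).toLp
        = - inner ℝ ((EuclideanSpace.proj (𝕜 := ℝ) i).compLpL 2 (vol Ω) p.snd)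
          (memLp_testFunction φ).toLp} := by
    ext p
    simp only [Set.mem_iInter]
    refine forall_congr' fun φ => forall_congr' fun i => ?_
    rw [Set.mem_ofPred_eq, L2.inner_def, L2.inner_def]
    have h1 : ∫ x, p.fst x * fderiv ℝ φ x (EuclideanSpace.single i 1) ∂(vol Ω) =
        ∫ x, inner ℝ (p.fst x)
          ((memLp_fderiv_testFunction φ (EuclideanSpace.single i 1)).toLp _ x) ∂(vol Ω) := by
      refine integral_congr_ae ?_
      filter_upwards [(memLp_fderiv_testFunction (Ω := Ω) φ (EuclideanSpace.single i 1)).coeFn_toLp]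
        with x hx
      rw [hx, real_inner_comm]; rfl
    have h2 : ∫ x, p.snd x i * φ x ∂(vol Ω) =
        ∫ x, inner ℝ ((EuclideanSpace.proj (𝕜 := ℝ) i).compLpL 2 (vol Ω) p.snd x)
          ((memLp_testFunction φ).toLp _ x) ∂(vol Ω) := by
      refine integral_congr_ae ?_
      filter_upwards [(memLp_testFunction (Ω := Ω) φ).coeFn_toLp,
        (EuclideanSpace.proj (𝕜 := ℝ) i).coeFn_compLpL (p := 2) (μ := vol Ω) p.snd] with x hx hx'
      rw [hx, hx', real_inner_comm]; rfl
    rw [← h1, ← h2]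
  rw [h]
  refine isClosed_iInter fun φ => isClosed_iInter fun i => isClosed_eq ?_ ?_
  · exact (WithLp.fstL 2 ℝ _ _).continuous.inner continuous_const
  · exact ((((EuclideanSpace.proj (𝕜 := ℝ) i).compLpL 2 (vol Ω)).continuous.comp
      (WithLp.sndL 2 ℝ _ _).continuous).inner continuous_const).neg

instance : CompleteSpace (H1 Ω) := isClosed_H1.completeSpace_coe

instance : CompleteSpace (H10 Ω) :=
  (Submodule.isClosed_topologicalClosure (testH1 Ω)).completeSpace_coe

/-- The embedding of `H¹₀(Ω)` into `L²(Ω)` as a continuous linear map. -/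
noncomputable def fnL : H10 Ω →L[ℝ] L2 Ω :=
  (WithLp.fstL 2 ℝ _ _).comp ((H1 Ω).subtypeL.comp (H10 Ω).subtypeL)

/-- The weak gradient as a continuous linear map. -/
noncomputable def gradL : H10 Ω →L[ℝ] L2Vec Ω :=
  (WithLp.sndL 2 ℝ _ _).comp ((H1 Ω).subtypeL.comp (H10 Ω).subtypeL)

theorem fn_sub (v w : H10 Ω) : fn (v - w) = fn v - fn w := map_sub fnL v w

theorem grad_sub (v w : H10 Ω) : grad (v - w) = grad v - grad w := map_sub gradL v w

theorem norm_sq_eq (v : H10 Ω) : ‖v‖ ^ 2 = ‖fn v‖ ^ 2 + ‖grad v‖ ^ 2 :=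
  WithLp.prod_norm_sq_eq_of_L2 (v.1.1)

theorem norm_fn_le (v : H10 Ω) : ‖fn v‖ ≤ ‖v‖ := by
  have h : ‖fn v‖ ^ 2 ≤ ‖v‖ ^ 2 := by
    rw [norm_sq_eq]
    exact le_add_of_nonneg_right (sq_nonneg _)
  exact (sq_le_sq₀ (norm_nonneg _) (norm_nonneg v)).1 h

theorem norm_grad_le (v : H10 Ω) : ‖grad v‖ ≤ ‖v‖ := by
  have h : ‖grad v‖ ^ 2 ≤ ‖v‖ ^ 2 := by
    rw [norm_sq_eq]
    exact le_add_of_nonneg_left (sq_nonneg _)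
  exact (sq_le_sq₀ (norm_nonneg _) (norm_nonneg v)).1 h

theorem norm_le_add (v : H10 Ω) : ‖v‖ ≤ ‖fn v‖ + ‖grad v‖ := by
  have h : ‖v‖ ^ 2 ≤ (‖fn v‖ + ‖grad v‖) ^ 2 := by
    rw [norm_sq_eq]
    nlinarith [norm_nonneg (fn v), norm_nonneg (grad v)]
  exact (sq_le_sq₀ (norm_nonneg v) (by positivity)).1 h

theorem secondCountableTopology_H10 : SecondCountableTopology (H10 Ω) := by
  have : Fact ((2 : ℝ≥0∞) ≠ ∞) := ⟨by simp⟩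
  have h1 : SecondCountableTopology (L2 Ω) := inferInstance
  have h2 : SecondCountableTopology (L2Vec Ω) := inferInstance
  have h3 : SecondCountableTopology (WithLp 2 (L2 Ω × L2Vec Ω)) :=
    WithLp.secondCountableTopology _ _ _
  have h4 : SecondCountableTopology (H1 Ω) := Subtype.secondCountableTopology _
  exact Subtype.secondCountableTopology _

end Hilbert

/-! ### The superposition operator and its potential. -/

section Nemytskii

/-- Taylor remainder of a primitive: it is the integral of `g s - g y` from `y` to `w`, bounded by
that of `L * |s - y|`. -/
theorem abs_integral_sub_mul_le {g : ℝ → ℝ} {L : ℝ} (hL : ∀ s t, |g s - g t| ≤ L * |s - t|)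
    (hg : Continuous g) (y w : ℝ) :
    |(∫ s in (0 : ℝ)..w, g s) - (∫ s in (0 : ℝ)..y, g s) - g y * (w - y)|
      ≤ L / 2 * (w - y) ^ 2 := by
  have h1 : (∫ s in (0 : ℝ)..w, g s) - (∫ s in (0 : ℝ)..y, g s) - g y * (w - y)
      = ∫ s in y..w, (g s - g y) := by
    rw [intervalIntegral.integral_interval_sub_left (hg.intervalIntegrable _ _)
      (hg.intervalIntegrable _ _), intervalIntegral.integral_sub (hg.intervalIntegrable _ _)
      (by simp)]
    simp [mul_comm]
  have h2 : ∀ a b : ℝ, ∫ s in a..b, L * (s - y) = L / 2 * (b - y) ^ 2 - L / 2 * (a - y) ^ 2 := by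
    intro a b
    refine intervalIntegral.integral_eq_sub_of_hasDerivAt (f := fun s => L / 2 * (s - y) ^ 2)
      (fun s _ => ?_)
      ((by fun_prop : Continuous fun s => L * (s - y)).intervalIntegrable _ _)
    have := (((hasDerivAt_id' s).sub_const y).pow 2).const_mul (L / 2)
    exact this.congr_deriv (by push_cast; ring)
  rw [h1]
  rcases le_total y w with h | h
  · have := intervalIntegral.norm_integral_le_of_norm_le (f := fun s => g s - g y)
      (g := fun s => L * (s - y)) (μ := volume) h
      (Eventually.of_forall fun s hs => by
        have := hL s y
        rwa [abs_of_nonneg (a := s - y) (by linarith [hs.1])] at this)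
      ((by fun_prop : Continuous fun s => L * (s - y)).intervalIntegrable _ _)
    rw [h2] at this
    simpa using this
  · have := intervalIntegral.norm_integral_le_of_norm_le (f := fun s => g s - g y)
      (g := fun s => -(L * (s - y))) (μ := volume) h
      (Eventually.of_forall fun s hs => by
        have := hL s y
        rwa [abs_of_nonpos (a := s - y) (by linarith [hs.2]), mul_neg] at this)
      ((by fun_prop : Continuous fun s => -(L * (s - y))).intervalIntegrable _ _)
    rw [intervalIntegral.integral_neg, h2] at this
    rw [intervalIntegral.integral_symm, abs_neg]
    simpa using this

variable {d : ℕ} {Ω : Opens (Space d)} {f : Space d → ℝ → ℝ} {ρ : ℝ}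

/-- Up to a null set, an admissible nonlinearity is jointly measurable and Lipschitz. -/
theorem Admissible.exists_lipschitz_version (hf : Admissible Ω f ρ) (hρ : 0 < ρ) {l : ℝ}
    (hl : l ∈ Lambda Ω f ρ) :
    ∃ g : Space d → ℝ → ℝ, (∀ᵐ x ∂(vol Ω), f x = g x) ∧
      StronglyMeasurable (fun p : Space d × ℝ => g p.1 p.2) ∧ (∀ x, Continuous (g x)) ∧
      ∀ x s t, |g x s - g x t| ≤ (ρ + 2 / l) * |s - t| := by
  obtain ⟨hl0, hσ⟩ := hl
  have hb : ∀ᵐ x ∂(vol Ω), ∀ t, |deriv (f x) t + 1 / l| ≤ ρ + 1 / l := by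
    have h := ENNReal.ae_le_essSup (μ := vol Ω)
      (fun x => ⨆ u : ℝ, ENNReal.ofReal |deriv (f x) u + 1 / l|)
    filter_upwards [h] with x hx t
    have h1 := ((le_iSup (fun u : ℝ => ENNReal.ofReal |deriv (f x) u + 1 / l|) t).trans hx).trans
      hσ.le
    exact (ENNReal.ofReal_le_ofReal_iff (by positivity)).1 h1
  -- The exceptional null set depends on the second argument; restricting to rationals keeps the
  -- union null, and continuity recovers real arguments below.
  have hm : ∀ᵐ x ∂(vol Ω), ∀ q : ℚ, f x q = (hf.measurable q).mk _ x := by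
    rw [ae_all_iff]
    exact fun q => (hf.measurable q).ae_eq_mk
  have hall : ∀ᵐ x ∂(vol Ω), x ∈ Ω ∧ (∀ t, |deriv (f x) t + 1 / l| ≤ ρ + 1 / l) ∧
      ∀ q : ℚ, f x q = (hf.measurable q).mk _ x := by
    filter_upwards [ae_restrict_mem Ω.isOpen.measurableSet, hb, hm] with x h1 h2 h3
    exact ⟨h1, h2, h3⟩
  obtain ⟨G, hG, hGm, hGP⟩ := hall.exists_measurable_mem
  classical
  have hlip : ∀ x s t, |(if x ∈ G then f x s else 0) - (if x ∈ G then f x t else 0)|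
      ≤ (ρ + 2 / l) * |s - t| := by
    intro x s t
    by_cases hx : x ∈ G
    · simp only [if_pos hx]
      obtain ⟨hxΩ, hd, -⟩ := hGP x hx
      refine Convex.norm_image_sub_le_of_norm_deriv_le (s := Set.univ)
        (fun r _ => hf.differentiable x hxΩ r) (fun r _ => ?_) convex_univ (Set.mem_univ t)
        (Set.mem_univ s)
      -- The derivative lies in `[-(ρ + 2 / l), ρ]`, whence the Lipschitz constant.
      have h1 := abs_le.1 (hd r)
      have h2 : 2 / l = 1 / l + 1 / l := by ring
      have h3 : 0 < 1 / l := by positivity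
      rw [Real.norm_eq_abs, abs_le, h2]
      constructor <;> linarith [h1.1, h1.2]
    · simp only [if_neg hx, sub_self, abs_zero]
      positivity
  have hcont : ∀ x, Continuous fun t => if x ∈ G then f x t else 0 := fun x =>
    (LipschitzWith.of_dist_le_mul (K := (ρ + 2 / l).toNNReal) fun s t => by
      rw [Real.coe_toNNReal _ (by positivity)]
      exact hlip x s t).continuous
  refine ⟨fun x t => if x ∈ G then f x t else 0, ?_, ?_, hcont, hlip⟩
  · filter_upwards [hG] with x hx
    ext t
    rw [if_pos hx]
  · have hq : ∀ q : ℚ, StronglyMeasurable fun x => if x ∈ G then f x q else 0 := by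
      intro q
      have : (fun x => if x ∈ G then f x q else 0) = G.indicator ((hf.measurable q).mk _) := by
        ext x
        by_cases hx : x ∈ G
        · rw [if_pos hx, Set.indicator_of_mem hx, (hGP x hx).2.2 q]
        · rw [if_neg hx, Set.indicator_of_notMem hx]
      rw [this]
      exact (hf.measurable q).stronglyMeasurable_mk.indicator hGm
    have ht : ∀ t : ℝ, StronglyMeasurable fun x => if x ∈ G then f x t else 0 := by
      intro t
      obtain ⟨r, hr, hrt⟩ := mem_closure_iff_seq_limit.1 (Rat.denseRange_cast (𝕜 := ℝ) t)
      choose q hqr using hr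
      refine stronglyMeasurable_of_tendsto atTop (fun n => hq (q n)) ?_
      rw [tendsto_pi_nhds]
      intro x
      refine ((hcont x).tendsto t).comp ?_
      simpa only [hqr] using hrt
    exact (stronglyMeasurable_uncurry_of_continuous_of_stronglyMeasurable
      (u := fun t x => if x ∈ G then f x t else 0) hcont ht).comp_measurable measurable_swap

/-- The Nemytskii operator `u ↦ f(·,u)` of an admissible nonlinearity and its potential. -/
theorem Admissible.exists_nemytskii (hf : Admissible Ω f ρ) (hρ : 0 < ρ) {l : ℝ}
    (hl : l ∈ Lambda Ω f ρ) :
    ∃ N : L2 Ω → L2 Ω, (∀ u, N u =ᵐ[vol Ω] fun x => f x (u x)) ∧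
      (∀ u w, ‖N u - N w‖ ≤ (ρ + 2 / l) * ‖u - w‖) ∧
      ∀ u w : L2 Ω, |(∫ x, (∫ s in (0 : ℝ)..(w x), f x s) ∂(vol Ω)) -
        (∫ x, (∫ s in (0 : ℝ)..(u x), f x s) ∂(vol Ω)) - inner ℝ (N u) (w - u)|
          ≤ (ρ + 2 / l) / 2 * ‖w - u‖ ^ 2 := by
  obtain ⟨g, hfg, hgm, hgc, hgL⟩ := hf.exists_lipschitz_version hρ hl
  have hl0 : 0 < l := hl.1
  set L := ρ + 2 / l
  have hg0 : MemLp (fun x => g x 0) 2 (vol Ω) := by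
    refine hf.memLp_zero.ae_eq ?_
    filter_upwards [hfg] with x hx
    rw [hx]
  have hcomp : ∀ u : L2 Ω, MemLp (fun x => g x (u x)) 2 (vol Ω) := by
    intro u
    refine (hg0.norm.add ((Lp.memLp u).norm.const_mul L)).mono
      (hgm.comp_measurable
        (measurable_id.prodMk (Lp.stronglyMeasurable u).measurable)).aestronglyMeasurable
      (Eventually.of_forall fun x => ?_)
    have h1 := hgL x (u x) 0
    rw [sub_zero] at h1
    have h2 : |g x (u x)| ≤ |g x (u x) - g x 0| + |g x 0| := by
      simpa using abs_add_le (g x (u x) - g x 0) (g x 0)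
    refine le_trans ?_ (le_abs_self _)
    simp only [Pi.add_apply, Real.norm_eq_abs]
    linarith
  let F : Space d → ℝ → ℝ := fun x t => ∫ s in (0 : ℝ)..t, g x s
  have hFm : StronglyMeasurable fun p : Space d × ℝ => F p.1 p.2 := by
    -- The substitution `s = t r` fixes the domain of integration, so joint measurability of `g`
    -- carries over to `F`.
    have h1 : (fun p : Space d × ℝ => F p.1 p.2) =
        fun p : Space d × ℝ => p.2 * ∫ r in Set.Ioc (0 : ℝ) 1, g p.1 (p.2 * r) := by
      ext p
      rw [← intervalIntegral.integral_of_le zero_le_one,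
        intervalIntegral.mul_integral_comp_mul_left]
      simp [F]
    rw [h1]
    refine measurable_snd.stronglyMeasurable.mul ?_
    have h2 : StronglyMeasurable fun q : (Space d × ℝ) × ℝ => g q.1.1 (q.1.2 * q.2) :=
      hgm.comp_measurable (by fun_prop :
        Measurable fun q : (Space d × ℝ) × ℝ => (q.1.1, q.1.2 * q.2))
    exact h2.integral_prod_right'
  have hquad : ∀ x y w, |F x w - F x y - g x y * (w - y)| ≤ L / 2 * (w - y) ^ 2 := fun x y w =>
    abs_integral_sub_mul_le (hgL x) (hgc x) y w
  have hFi : ∀ u : L2 Ω, Integrable (fun x => F x (u x)) (vol Ω) := by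
    intro u
    have h1 : Integrable (fun x => g x 0 * u x) (vol Ω) := hg0.integrable_mul (Lp.memLp u)
    have h2 : Integrable (fun x => L / 2 * u x ^ 2) (vol Ω) :=
      (Lp.memLp u).integrable_sq.const_mul _
    refine (h1.norm.add h2).mono
      (hFm.comp_measurable
        (measurable_id.prodMk (Lp.stronglyMeasurable u).measurable)).aestronglyMeasurable
      (Eventually.of_forall fun x => ?_)
    have h3 := hquad x 0 (u x)
    have h0 : F x 0 = 0 := intervalIntegral.integral_same
    rw [h0, sub_zero, sub_zero] at h3
    refine le_trans ?_ (le_abs_self _)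
    have h4 : |F x (u x)| ≤ |F x (u x) - g x 0 * u x| + |g x 0 * u x| := by
      simpa using abs_add_le (F x (u x) - g x 0 * u x) (g x 0 * u x)
    simp only [Pi.add_apply, Real.norm_eq_abs]
    linarith
  have hN : ∀ u, (hcomp u).toLp _ =ᵐ[vol Ω] fun x => g x (u x) := fun u => (hcomp u).coeFn_toLp
  refine ⟨fun u => (hcomp u).toLp, fun u => ?_, fun u w => ?_, fun u w => ?_⟩
  · filter_upwards [hN u, hfg] with x h1 h2
    rw [h1, h2]
  · refine Lp.norm_le_mul_norm_of_ae_le_mul ?_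
    filter_upwards [hN u, hN w, Lp.coeFn_sub ((hcomp u).toLp) ((hcomp w).toLp),
      Lp.coeFn_sub u w] with x h1 h2 h3 h4
    rw [h3, h4, Pi.sub_apply, Pi.sub_apply, h1, h2]
    exact hgL x _ _
  · have hF : ∀ u : L2 Ω, (∫ x, (∫ s in (0 : ℝ)..(u x), f x s) ∂(vol Ω)) =
        ∫ x, F x (u x) ∂(vol Ω) := by
      intro u
      refine integral_congr_ae ?_
      filter_upwards [hfg] with x hx
      rw [hx]
    have hin : Integrable (fun x => inner ℝ ((hcomp u).toLp _ x) ((w - u : L2 Ω) x)) (vol Ω) :=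
      L2.integrable_inner _ _
    have hFi' : Integrable (fun x => F x (w x) - F x (u x)) (vol Ω) := (hFi w).sub (hFi u)
    have hsq : Integrable (fun x => inner ℝ ((w - u : L2 Ω) x) ((w - u : L2 Ω) x)) (vol Ω) :=
      L2.integrable_inner _ _
    beta_reduce
    rw [hF, hF, L2.inner_def, ← integral_sub (hFi w) (hFi u), ← integral_sub hFi' hin, ← real_inner_self_eq_norm_sq, L2.inner_def,
      ← integral_const_mul, ← Real.norm_eq_abs]
    refine norm_integral_le_of_norm_le (hsq.const_mul _) ?_
    filter_upwards [hN u, Lp.coeFn_sub w u] with x h1 h2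
    rw [h1, h2, Pi.sub_apply, real_inner_self_eq_norm_sq, Real.norm_eq_abs, Real.norm_eq_abs,
      sq_abs, real_inner_comm]
    exact hquad x _ _

end Nemytskii

/-! ### Energy descent, a priori bounds and limits. -/

section Convergence

variable {d : ℕ} {Ω : Opens (Space d)} {f : Space d → ℝ → ℝ} {ρ : ℝ}

theorem poincareConst_mul_le (v : H10 Ω) :
    1 / (2 * poincareConst Ω) * ‖fn v‖ ^ 2 ≤ 1 / 2 * ‖grad v‖ ^ 2 := by
  set S := {C : ℝ | 0 < C ∧ ∀ v : H10 Ω, ‖fn v‖ ^ 2 ≤ C * ‖grad v‖ ^ 2} with hS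
  have hP : poincareConst Ω = sInf S := rfl
  have hP0 : 0 ≤ poincareConst Ω := Real.sInf_nonneg fun C hC => hC.1.le
  -- If the set of admissible constants is empty, its `sInf` is `0`; then `1 / 0 = 0` makes the
  -- claim trivial, so existence of a Poincaré constant need not be proved.
  rcases hP0.eq_or_lt with h | h
  · rw [← h, mul_zero, div_zero, zero_mul]
    positivity
  have hne : S.Nonempty := by
    by_contra hempty
    rw [hP, Set.not_nonempty_iff_eq_empty.1 hempty, Real.sInf_empty] at h
    exact lt_irrefl _ h
  have hcl : IsClosed {C : ℝ | ‖fn v‖ ^ 2 ≤ C * ‖grad v‖ ^ 2} :=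
    isClosed_le continuous_const (by fun_prop)
  have hmem : ‖fn v‖ ^ 2 ≤ poincareConst Ω * ‖grad v‖ ^ 2 :=
    closure_minimal (s := S) (fun C hC => hC.2 v) hcl
      (csInf_mem_closure hne ⟨0, fun C hC => hC.1.le⟩)
  rw [div_mul_eq_mul_div, one_mul, div_le_iff₀ (by positivity)]
  linarith

/-- `mu` is the infimum of `1 / l` over `Lambda`, possibly not attained; the strict inequality
leaves room for an actual element `l`. -/
theorem exists_mem_Lambda_of_kappa_lt (hf : Admissible Ω f ρ) {c : ℝ} (hc : kappa Ω f ρ < c) :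
    ∃ l ∈ Lambda Ω f ρ, 1 / l + ρ / 2 - 1 / (2 * poincareConst Ω) < c := by
  have h1 : mu Ω f ρ + ρ / 2 - 1 / (2 * poincareConst Ω) < c := (le_max_left _ _).trans_lt hc
  set m := c - ρ / 2 + 1 / (2 * poincareConst Ω) with hm
  have h2 : mu Ω f ρ < m := by linarith
  suffices h : ∃ l ∈ Lambda Ω f ρ, m⁻¹ < l by
    obtain ⟨l, hl, hlm⟩ := h
    refine ⟨l, hl, ?_⟩
    have hm0 : 0 < m := by
      refine lt_of_le_of_lt ?_ h2
      rw [mu]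
      split_ifs
      · exact inv_nonneg.2 (Real.sSup_nonneg fun x hx => hx.1.le)
      · exact le_rfl
    have := inv_lt_of_inv_lt₀ hm0 hlm
    rw [one_div]
    linarith
  rw [mu] at h2
  split_ifs at h2 with hbdd
  · obtain ⟨l0, hl0⟩ := hf.nonempty
    have hpos : 0 < sSup (Lambda Ω f ρ) := hl0.1.trans_le (le_csSup hbdd hl0)
    exact exists_lt_of_lt_csSup hf.nonempty (inv_lt_of_inv_lt₀ hpos h2)
  · exact not_bddAbove_iff.1 hbdd _

theorem formB_eq (c : ℝ) (u v : H10 Ω) :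
    formB c u v = c * inner ℝ (grad u) (grad v) + inner ℝ (fn u) (fn v) := by
  rw [formB, integral_add ((L2.integrable_inner (𝕜 := ℝ) (grad u) (grad v)).const_mul c),
    integral_const_mul, L2.inner_def, L2.inner_def]
  · congr 2
    ext x
    exact mul_comm _ _
  · exact (Lp.memLp (fn u)).integrable_mul (Lp.memLp (fn v))

theorem integral_mul_fn_eq (y : L2 Ω) {h : Space d → ℝ} (hy : y =ᵐ[vol Ω] h) (v : H10 Ω) :
    ∫ x, h x * fn v x ∂(vol Ω) = inner ℝ y (fn v) := by
  rw [L2.inner_def]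
  refine integral_congr_ae ?_
  filter_upwards [hy] with x hx
  rw [hx, real_inner_comm]
  rfl

theorem formL_eq {N : L2 Ω → L2 Ω} (hN : ∀ u, N u =ᵐ[vol Ω] fun x => f x (u x)) (c : ℝ)
    (y : L2 Ω) (v : H10 Ω) : formL f c y v = inner ℝ (y + c • N y) (fn v) := by
  refine integral_mul_fn_eq _ ?_ v
  filter_upwards [Lp.coeFn_add y (c • N y), Lp.coeFn_smul c (N y), hN y] with x h1 h2 h3
  rw [h1, Pi.add_apply, h2, Pi.smul_apply, h3, smul_eq_mul]

theorem energy_eq (v : H10 Ω) : energy f v = 1 / 2 * ‖grad v‖ ^ 2 -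
    ∫ x, (∫ s in (0 : ℝ)..(fn v x), f x s) ∂(vol Ω) := by
  rw [energy, ← real_inner_self_eq_norm_sq (grad v), L2.inner_def]
  simp_rw [real_inner_self_eq_norm_sq]

/-- One step of the iteration decreases the energy. -/
theorem energy_step_le {N : L2 Ω → L2 Ω} {L dt : ℝ} (hdt : 0 < dt)
    (hΦ : ∀ u w : L2 Ω, |(∫ x, (∫ s in (0 : ℝ)..(w x), f x s) ∂(vol Ω)) -
        (∫ x, (∫ s in (0 : ℝ)..(u x), f x s) ∂(vol Ω)) - inner ℝ (N u) (w - u)|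
          ≤ L / 2 * ‖w - u‖ ^ 2) {w y : H10 Ω}
    (hstep : dt * inner ℝ (grad w) (grad (w - y)) + inner ℝ (fn w) (fn (w - y))
      = inner ℝ (fn y + dt • N (fn y)) (fn (w - y))) :
    energy f w + (1 / dt - L / 2 + 1 / (2 * poincareConst Ω)) * ‖fn w - fn y‖ ^ 2
      ≤ energy f y := by
  have h1 := (abs_le.1 (hΦ (fn y) (fn w))).1
  have h2 := poincareConst_mul_le (w - y)
  -- Expanding around the new iterate `w` leaves the surplus `1/2 ‖∇(w - y)‖²`, which `h2` converts
  -- into the Poincaré part of the coefficient.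
  have h3 : ‖grad y‖ ^ 2 = ‖grad w‖ ^ 2 - 2 * inner ℝ (grad w) (grad (w - y))
      + ‖grad (w - y)‖ ^ 2 := by
    rw [← norm_sub_sq_real, grad_sub, sub_sub_cancel]
  have h4 : inner ℝ (grad w) (grad (w - y)) + 1 / dt * ‖fn w - fn y‖ ^ 2
      = inner ℝ (N (fn y)) (fn w - fn y) := by
    have h5 : inner ℝ (fn w) (fn (w - y)) - inner ℝ (fn y) (fn (w - y)) = ‖fn w - fn y‖ ^ 2 := by
      rw [← inner_sub_left, fn_sub, real_inner_self_eq_norm_sq]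
    rw [inner_add_left, real_inner_smul_left] at hstep
    rw [← fn_sub] at h5 ⊢
    field_simp
    linarith
  rw [energy_eq, energy_eq]
  rw [fn_sub] at h2
  linarith

theorem exists_bound_of_energy_le {lam : ℝ} (hlam : 0 < lam) (hcoer : WeaklyCoercive Ω f lam)
    (e : ℝ) : ∃ C : ℝ, ∀ v : H10 Ω, energy f v ≤ e → ‖fn v‖ ≤ C ∧ ‖grad v‖ ≤ C := by
  obtain ⟨t, ht, hsub⟩ := mem_comap.1 (hcoer.eventually_gt_atTop e)
  obtain ⟨R, hR⟩ := mem_atTop_sets.1 ht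
  have hbd : ∀ v : H10 Ω, energy f v ≤ e → lam * ‖grad v‖ ^ 2 + ‖fn v‖ ^ 2 ≤ R ^ 2 := by
    intro v hv
    have h1 : lamNorm lam v < R := by
      by_contra h
      exact absurd hv (not_le.2 (hsub (hR _ (not_lt.1 h))))
    rw [lamNorm] at h1
    exact (Real.sqrt_le_left ((Real.sqrt_nonneg _).trans h1.le)).1 h1.le
  refine ⟨max |R| (Real.sqrt (R ^ 2 / lam)), fun v hv => ⟨le_max_of_le_left ?_,
    le_max_of_le_right ?_⟩⟩
  · have := hbd v hv
    have h2 := sq_le_sq (a := ‖fn v‖) (b := R) |>.1 (by nlinarith [sq_nonneg ‖grad v‖])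
    rwa [abs_norm] at h2
  · refine Real.le_sqrt_of_sq_le ?_
    rw [le_div_iff₀ hlam]
    linarith [hbd v hv, sq_nonneg ‖fn v‖]

/-- The Taylor bound at `0`, where the potential vanishes, bounds the energy below on `L²`-bounded
sets. -/
theorem neg_le_energy {N : L2 Ω → L2 Ω} {L C : ℝ} (hL0 : 0 ≤ L)
    (hΦ : ∀ u w : L2 Ω, |(∫ x, (∫ s in (0 : ℝ)..(w x), f x s) ∂(vol Ω)) -
        (∫ x, (∫ s in (0 : ℝ)..(u x), f x s) ∂(vol Ω)) - inner ℝ (N u) (w - u)|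
          ≤ L / 2 * ‖w - u‖ ^ 2) {v : H10 Ω} (hv : ‖fn v‖ ≤ C) :
    -(‖N 0‖ * C + L / 2 * C ^ 2) ≤ energy f v := by
  have h1 := (abs_le.1 (hΦ 0 (fn v))).2
  have h0 : ∫ x, (∫ s in (0 : ℝ)..((0 : L2 Ω) x), f x s) ∂(vol Ω) = 0 := by
    refine integral_eq_zero_of_ae ?_
    filter_upwards [Lp.coeFn_zero ℝ 2 (vol Ω)] with x hx
    rw [hx, Pi.zero_apply, intervalIntegral.integral_same]
  rw [h0, sub_zero, sub_zero] at h1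
  have h2 : inner ℝ (N 0) (fn v) ≤ ‖N 0‖ * C :=
    (real_inner_le_norm _ _).trans (by gcongr)
  have h3 : L / 2 * ‖fn v‖ ^ 2 ≤ L / 2 * C ^ 2 := by gcongr
  rw [energy_eq]
  linarith [sq_nonneg ‖grad v‖]

/-- A decreasing sequence bounded below converges, so its decrements, which dominate `γ * δ n ^ 2`,
tend to zero. -/
theorem tendsto_zero_of_descent {e δ : ℕ → ℝ} {γ : ℝ} (hγ : 0 < γ) (hδ : ∀ n, 0 ≤ δ n)
    (he : ∀ n, e (n + 1) + γ * δ n ^ 2 ≤ e n) (hb : BddBelow (Set.range e)) :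
    Tendsto δ atTop (𝓝 0) := by
  have hanti : Antitone e :=
    antitone_nat_of_succ_le fun n => by linarith [he n, mul_nonneg hγ.le (sq_nonneg (δ n))]
  have hconv := tendsto_atTop_ciInf hanti hb
  have h1 : Tendsto (fun n => (e n - e (n + 1)) / γ) atTop (𝓝 0) := by
    have := (hconv.sub ((tendsto_add_atTop_iff_nat 1).2 hconv)).div_const γ
    simpa using this
  have h2 : Tendsto (fun n => δ n ^ 2) atTop (𝓝 0) := by
    refine squeeze_zero (fun n => sq_nonneg _) (fun n => ?_) h1
    rw [le_div_iff₀ hγ]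
    linarith [he n]
  have h3 := h2.sqrt
  simpa [Real.sqrt_sq (hδ _)] using h3

/-- Bounded sequences in a closed subspace of `H¹₀(Ω)` have weakly convergent subsequences. -/
theorem exists_subseq_tendsto_weak_H10 (W : Submodule ℝ (H10 Ω))
    (hW : IsClosed (W : Set (H10 Ω))) {x : ℕ → W} {C : ℝ} (hx : ∀ n, ‖(x n : H10 Ω)‖ ≤ C) :
    ∃ (ns : ℕ → ℕ) (y : W), StrictMono ns ∧
      ∀ ℓ : StrongDual ℝ W, Tendsto (fun k => ℓ (x (ns k))) atTop (𝓝 (ℓ y)) := by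
  have hsc : SecondCountableTopology (H10 Ω) := secondCountableTopology_H10
  have h := exists_subseq_tendsto_weak_submodule (H := H10 Ω) W hW (x := x) (C := C)
  exact h hx

theorem tendsto_toWeakSpace {W : Submodule ℝ (H10 Ω)} {w : ℕ → W} {z : W}
    (hw : ∀ ℓ : StrongDual ℝ W, Tendsto (fun n => ℓ (w n)) atTop (𝓝 (ℓ z))) :
    Tendsto (fun n => toWeakSpace ℝ W (w n)) atTop (𝓝 (toWeakSpace ℝ W z)) :=
  (IsInducing.tendsto_nhds_iff ⟨rfl⟩).2 (tendsto_pi_nhds.2 hw)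

theorem tendsto_inner_grad_of_weak {W : Submodule ℝ (H10 Ω)} {w : ℕ → W} {z : W}
    (hw : ∀ ℓ : StrongDual ℝ W, Tendsto (fun n => ℓ (w n)) atTop (𝓝 (ℓ z))) (a : L2Vec Ω) :
    Tendsto (fun n => inner ℝ (grad (w n : H10 Ω)) a) atTop
      (𝓝 (inner ℝ (grad (z : H10 Ω)) a)) := by
  simp_rw [real_inner_comm a]
  exact hw ((innerSL ℝ a).comp (gradL.comp W.subtypeL))

/-- Weak convergence in a subspace of `H¹₀(Ω)` implies strong convergence in `L²(Ω)`. -/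
theorem tendsto_fn_of_weak [IsFiniteMeasure (vol Ω)] {W : Submodule ℝ (H10 Ω)} {w : ℕ → W} {z : W}
    {C : ℝ} (hC : ∀ n, ‖(w n : H10 Ω)‖ ≤ C)
    (hw : ∀ ℓ : StrongDual ℝ W, Tendsto (fun n => ℓ (w n)) atTop (𝓝 (ℓ z))) :
    Tendsto (fun n => fn (w n : H10 Ω)) atTop (𝓝 (fn (z : H10 Ω))) := by
  -- Rellich is available for weak limit zero, hence is applied to the differences `w n - z`.
  have hb : ∀ n, ‖((w n - z : W) : H10 Ω)‖ ≤ C + ‖(z : H10 Ω)‖ := fun n =>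
    (norm_sub_le (w n : H10 Ω) (z : H10 Ω)).trans (by gcongr; exact hC n)
  have key := tendsto_fn_zero (v := fun n => ((w n - z : W) : H10 Ω)) (C := C + ‖(z : H10 Ω)‖)
    (fun n => (norm_fn_le _).trans (hb n)) (fun n => (norm_grad_le _).trans (hb n)) (fun a => by
      have h1 := hw ((innerSL ℝ a).comp (fnL.comp W.subtypeL))
      have h2 := h1.sub_const (inner ℝ a (fn (z : H10 Ω)))
      have h3 : inner ℝ a (fn (z : H10 Ω)) - inner ℝ a (fn (z : H10 Ω)) = (0 : ℝ) := sub_self _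
      rw [← h3]
      refine h2.congr fun n => ?_
      rw [Submodule.coe_sub, fn_sub, inner_sub_right]
      rfl)
  rw [← tendsto_sub_nhds_zero_iff]
  refine key.congr fun n => ?_
  rw [Submodule.coe_sub, fn_sub]

end Convergence

/-! ### Convergence of the iteration. -/

section Main

variable {d : ℕ} {Ω : Opens (Space d)} {f : Space d → ℝ → ℝ} {ρ : ℝ}

/-- The iterates are bounded in `H¹₀(Ω)` and consecutive ones approach each other in `L²(Ω)`. -/
theorem exists_bound_and_tendsto_sub {N : L2 Ω → L2 Ω} {L dt lam : ℝ} (hdt : 0 < dt) (hL0 : 0 ≤ L)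
    (hΦ : ∀ u w : L2 Ω, |(∫ x, (∫ s in (0 : ℝ)..(w x), f x s) ∂(vol Ω)) -
        (∫ x, (∫ s in (0 : ℝ)..(u x), f x s) ∂(vol Ω)) - inner ℝ (N u) (w - u)|
          ≤ L / 2 * ‖w - u‖ ^ 2)
    (hγ : 0 < 1 / dt - L / 2 + 1 / (2 * poincareConst Ω))
    (hlam : 0 < lam) (hcoer : WeaklyCoercive Ω f lam)
    {W : Submodule ℝ (H10 Ω)} {u : ℕ → L2 Ω} {w : ℕ → H10 Ω} (hwW : ∀ n, w n ∈ W)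
    (hwu : ∀ n, fn (w n) = u (n + 1))
    (heq : ∀ n, ∀ v ∈ W, dt * inner ℝ (grad (w n)) (grad v) + inner ℝ (fn (w n)) (fn v)
      = inner ℝ (u n + dt • N (u n)) (fn v)) :
    ∃ C : ℝ, (∀ n, ‖fn (w n)‖ ≤ C ∧ ‖grad (w n)‖ ≤ C) ∧
      Tendsto (fun n => u (n + 1) - u n) atTop (𝓝 0) := by
  have hdec : ∀ n, energy f (w (n + 1)) + (1 / dt - L / 2 + 1 / (2 * poincareConst Ω)) *
      ‖u (n + 2) - u (n + 1)‖ ^ 2 ≤ energy f (w n) := by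
    intro n
    -- The increment is admissible as a test function only from `w 0`, that is `u 1`, onwards: `u 0`
    -- is merely in `L²(Ω)`.
    have h1 := heq (n + 1) _ (W.sub_mem (hwW (n + 1)) (hwW n))
    rw [← hwu n] at h1
    have h2 := energy_step_le hdt hΦ h1
    rwa [hwu (n + 1), hwu n] at h2
  have hanti : Antitone fun n => energy f (w n) :=
    antitone_nat_of_succ_le fun n => by
      linarith [hdec n, mul_nonneg hγ.le (sq_nonneg ‖u (n + 2) - u (n + 1)‖)]
  have hbound := exists_bound_of_energy_le hlam hcoer (energy f (w 0))
  obtain ⟨C, hC⟩ := hbound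
  have hCw : ∀ n, ‖fn (w n)‖ ≤ C ∧ ‖grad (w n)‖ ≤ C := fun n => hC (w n) (hanti (Nat.zero_le n))
  refine ⟨C, hCw, ?_⟩
  rw [← tendsto_add_atTop_iff_nat 1, tendsto_zero_iff_norm_tendsto_zero]
  refine tendsto_zero_of_descent (e := fun n => energy f (w n)) hγ (fun n => norm_nonneg _) hdec
    ⟨-(‖N 0‖ * C + L / 2 * C ^ 2), ?_⟩
  rintro _ ⟨n, rfl⟩
  exact neg_le_energy hL0 hΦ (hCw n).1

/-- Passing to the limit in the iteration yields a solution of the Galerkin problem. -/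
theorem isGalerkinSolution_of_tendsto {N : L2 Ω → L2 Ω} {dt : ℝ} (hdt : 0 < dt)
    (hN : ∀ u, N u =ᵐ[vol Ω] fun x => f x (u x)) (hNc : Continuous N)
    {W : Submodule ℝ (H10 Ω)} {w : ℕ → W} {z : W} {y : ℕ → L2 Ω}
    (hz : ∀ ℓ : StrongDual ℝ W, Tendsto (fun k => ℓ (w k)) atTop (𝓝 (ℓ z)))
    (hw : Tendsto (fun k => fn (w k : H10 Ω)) atTop (𝓝 (fn (z : H10 Ω))))
    (hy : Tendsto y atTop (𝓝 (fn (z : H10 Ω))))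
    (heq : ∀ k, ∀ v ∈ W, dt * inner ℝ (grad (w k : H10 Ω)) (grad v) +
      inner ℝ (fn (w k : H10 Ω)) (fn v) = inner ℝ (y k + dt • N (y k)) (fn v)) :
    IsGalerkinSolution f W (z : H10 Ω) := by
  refine ⟨z.2, fun v hv => ?_⟩
  have h1 : Tendsto (fun k => dt * inner ℝ (grad (w k : H10 Ω)) (grad v)
      + inner ℝ (fn (w k : H10 Ω)) (fn v)) atTop
      (𝓝 (dt * inner ℝ (grad (z : H10 Ω)) (grad v) + inner ℝ (fn (z : H10 Ω)) (fn v))) :=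
    ((tendsto_inner_grad_of_weak hz (grad v)).const_mul dt).add (hw.inner tendsto_const_nhds)
  have h2 : Tendsto (fun k => inner ℝ (y k + dt • N (y k)) (fn v)) atTop
      (𝓝 (inner ℝ (fn (z : H10 Ω) + dt • N (fn (z : H10 Ω))) (fn v))) :=
    (hy.add (((hNc.tendsto _).comp hy).const_smul dt)).inner tendsto_const_nhds
  have h3 := tendsto_nhds_unique (h1.congr fun k => heq k v hv) h2
  rw [inner_add_left, real_inner_smul_left] at h3
  rw [integral_mul_fn_eq _ (hN _) v, ← L2.inner_def]
  exact mul_left_cancel₀ hdt.ne' (by linarith)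

/-- Consecutive iterates in a closed subspace that are bounded and approach each other have a
subsequence converging to a solution of the Galerkin problem. -/
theorem exists_subseq_isGalerkinSolution [IsFiniteMeasure (vol Ω)] {N : L2 Ω → L2 Ω} {dt C : ℝ}
    (hdt : 0 < dt) (hN : ∀ u, N u =ᵐ[vol Ω] fun x => f x (u x)) (hNc : Continuous N)
    {W : Submodule ℝ (H10 Ω)} (hW : IsClosed (W : Set (H10 Ω))) {u : ℕ → L2 Ω} {w : ℕ → W}
    (hwu : ∀ n, fn (w n : H10 Ω) = u (n + 1))
    (heq : ∀ n, ∀ v ∈ W, dt * inner ℝ (grad (w n : H10 Ω)) (grad v) +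
      inner ℝ (fn (w n : H10 Ω)) (fn v) = inner ℝ (u n + dt • N (u n)) (fn v))
    (hC : ∀ n, ‖(w n : H10 Ω)‖ ≤ C)
    (hδ : Tendsto (fun n => u (n + 1) - u n) atTop (𝓝 0)) :
    ∃ (ms : ℕ → ℕ) (z : W), StrictMono ms ∧
      Tendsto (fun k => toWeakSpace ℝ W (w (ms k))) atTop (𝓝 (toWeakSpace ℝ W z)) ∧
      Tendsto (fun k => u (ms k + 1)) atTop (𝓝 (fn (z : H10 Ω))) ∧
      IsGalerkinSolution f W (z : H10 Ω) := by
  have hsub := exists_subseq_tendsto_weak_H10 W hW (x := w) (C := C) hC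
  obtain ⟨ms, z, hms, hz⟩ := hsub
  have hstrong : Tendsto (fun k => fn (w (ms k) : H10 Ω)) atTop (𝓝 (fn (z : H10 Ω))) :=
    tendsto_fn_of_weak (w := fun k => w (ms k)) (C := C) (fun k => hC (ms k)) hz
  have hstrong' : Tendsto (fun k => u (ms k + 1)) atTop (𝓝 (fn (z : H10 Ω))) :=
    hstrong.congr fun k => hwu (ms k)
  -- The scheme couples two consecutive iterates; both must have the same limit for the mass terms
  -- to cancel.
  have hprev : Tendsto (fun k => u (ms k)) atTop (𝓝 (fn (z : H10 Ω))) := by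
    have := hstrong'.sub (hδ.comp hms.tendsto_atTop)
    simpa using this
  exact ⟨ms, z, hms, tendsto_toWeakSpace (w := fun k => w (ms k)) hz, hstrong',
    isGalerkinSolution_of_tendsto (w := fun k => w (ms k)) hdt hN hNc hz hstrong hprev
      fun k => heq (ms k)⟩

end Main

end SemilinearGalerkin

theorem mainTheorem6 {d : ℕ} (hd : 1 ≤ d) (Ω : Opens (Space d))
    (hΩne : (Ω : Set (Space d)).Nonempty) (hΩbdd : Bornology.IsBounded (Ω : Set (Space d)))
    (f : Space d → ℝ → ℝ) (ρ : ℝ) (hρ : 0 < ρ) (hf : Admissible Ω f ρ)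
    (dt : ℝ) (hdt : 0 < dt) (hstep : kappa Ω f ρ < 1 / dt)
    (lam : ℝ) (hlam : 0 < lam) (hcoer : WeaklyCoercive Ω f lam)
    (W : Submodule ℝ (H10 Ω)) (hW : IsClosed (W : Set (H10 Ω)))
    (u : ℕ → L2 Ω) (hu : IsIteration f W dt u) :
    ∃ (ns : ℕ → ℕ) (w : ℕ → W) (ustar : W), StrictMono ns ∧
      (∀ k, fn (w k : H10 Ω) = u (ns k)) ∧
      Tendsto (fun k => toWeakSpace ℝ W (w k)) atTop (𝓝 (toWeakSpace ℝ W ustar)) ∧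
      Tendsto (fun k => u (ns k)) atTop (𝓝 (fn (ustar : H10 Ω))) ∧
      IsGalerkinSolution f W (ustar : H10 Ω) := by
  have hfin : IsFiniteMeasure (vol Ω) :=
    ⟨by rw [Measure.restrict_apply_univ]; exact hΩbdd.measure_lt_top⟩
  obtain ⟨l, hl, hlt⟩ := exists_mem_Lambda_of_kappa_lt hf hstep
  obtain ⟨N, hN, hNL, hΦ⟩ := hf.exists_nemytskii hρ hl
  have hL0 : 0 < ρ + 2 / l := add_pos hρ (div_pos two_pos hl.1)
  -- Half the Lipschitz constant is `1 / l + ρ / 2`, the quantity controlled by the choice of `l`.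
  have hγ : 0 < 1 / dt - (ρ + 2 / l) / 2 + 1 / (2 * poincareConst Ω) := by
    have : (ρ + 2 / l) / 2 = 1 / l + ρ / 2 := by ring
    rw [this]
    linarith
  have hNc : Continuous N :=
    (LipschitzWith.of_dist_le_mul (K := (ρ + 2 / l).toNNReal) fun a b => by
      rw [Real.coe_toNNReal _ hL0.le, dist_eq_norm, dist_eq_norm]
      exact hNL a b).continuous
  choose w hwW hwu hweq using hu
  have heq : ∀ n, ∀ v ∈ W, dt * inner ℝ (grad (w n)) (grad v) + inner ℝ (fn (w n)) (fn v)
      = inner ℝ (u n + dt • N (u n)) (fn v) := by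
    intro n v hv
    rw [← formB_eq, ← formL_eq hN]
    exact hweq n v hv
  have hbound := exists_bound_and_tendsto_sub hdt hL0.le hΦ hγ hlam hcoer hwW hwu heq
  obtain ⟨C, hC, hδ⟩ := hbound
  have hlim := exists_subseq_isGalerkinSolution (w := fun n => (⟨w n, hwW n⟩ : W)) (C := C + C)
    hdt hN hNc hW hwu heq (fun n => (norm_le_add (w n)).trans (add_le_add (hC n).1 (hC n).2)) hδ
  obtain ⟨ms, z, hms, hweak, hstrong, hsol⟩ := hlim
  -- The shift by one reflects that `w n` represents `u (n + 1)`.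
  exact ⟨fun k => ms k + 1, fun k => ⟨w (ms k), hwW (ms k)⟩, z,
    fun a b hab => Nat.succ_lt_succ (hms hab), fun k => hwu (ms k), hweak, hstrong, hsol⟩
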